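/- Let $L>0$, $\Omega=(0,L)$, $0<\alpha_1\le\alpha_2$, $b\in\mathbb{R}\setminus\{0\}$ and $f\in L^2(\Omega)$. For each $\varepsilon>0$ let $A^\varepsilon:\Omega\to\mathbb{R}$ be measurable with $\alpha_1\le A^\varepsilon(x)\le\alpha_2$ for a.e. $x\in\Omega$, and let $u^\varepsilon\in H^1_0(\Omega)$ be the weak solution of $$-\bigl(A^\varepsilon (u^\varepsilon)'\bigr)'+b\,(u^\varepsilon)'=f\ \text{ in }\Omega,\qquad u^\varepsilon(0)=u^\varepsilon(L)=0,$$ that is, $a^\varepsilon(u^\varepsilon,v)=\int_\Omega fv$ for all $v\in H^1_0(\Omega)$, where $a^\varepsilon(u,v)=\int_\Omega A^\varepsilon u'v'+b\,u'v$. Let $0=x_0<x_1<\dots<x_N=L$ be a mesh of $\Omega$, of size $H=\max_{0\le j<N}(x_{j+1}-x_j)$, and for $1\le i\le N-1$ let $\phi_i^0$ be the $\mathbb{P}^1$ hat function of the node $x_i$. Let $\psi_i^\varepsilon\in H^1_0(\Omega)$ be the exact multiscale basis function: in each element $K=(x_j,x_{j+1})$ it is the weak solution of $-\bigl(A^\varepsilon(\psi_i^\varepsilon)'\bigr)'=0$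 in $K$, with $\psi_i^\varepsilon=\phi_i^0$ on $\partial K$. Let $V_H^\varepsilon=\mathrm{Span}\{\psi_i^\varepsilon,\ 1\le i\le N-1\}$, and let $u_H^\varepsilon\in V_H^\varepsilon$ be the (unstabilized) MsFEM approximation of $u^\varepsilon$, defined by $a^\varepsilon(u_H^\varepsilon,v)=\int_\Omega fv$ for all $v\in V_H^\varepsilon$. If $\dfrac{|b|L}{\alpha_2}\ge 1$, then, for every $\varepsilon>0$, $$|u^\varepsilon-u^\varepsilon_H|_{H^1(\Omega)}\le H\left(\sqrt{\frac{\alpha_2}{\alpha_1}}+\frac{|b|H}{\alpha_1}\right)\left(1+\frac{\sqrt{2\alpha_2L|b|}}{\alpha_1}\right)\frac{\|f\|_{L^2(\Omega)}}{\alpha_1},$$ where $|v|_{H^1(\Omega)}=\|v'\|_{L^2(\Omega)}$. In particular, the bound does not depend on $\varepsilon$. -/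

import Mathlib

open MeasureTheory Set
open scoped ContDiff

noncomputable section

namespace MsFEM

/-- Smooth functions with compact support in the open interval `(s, t)`. -/
def IsTestFunction (s t : ℝ) (φ : ℝ → ℝ) : Prop :=
  ContDiff ℝ ∞ φ ∧ HasCompactSupport φ ∧ tsupport φ ⊆ Ioo s t

/-- `g` is a weak (distributional) derivative of `u` on `(s, t)`. -/
def HasWeakDeriv (s t : ℝ) (u g : ℝ → ℝ) : Prop :=
  ∀ φ : ℝ → ℝ, IsTestFunction s t φ →
    ∫ x in Ioo s t, u x * deriv φ x = - ∫ x in Ioo s t, g x * φ x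

/-- `u ∈ L²(s, t)`. -/
def MemL2 (s t : ℝ) (u : ℝ → ℝ) : Prop :=
  MemLp u 2 (volume.restrict (Ioo s t))

/-- `u ∈ H¹(s, t)`: `u` is in `L²(s, t)` and has a weak derivative in `L²(s, t)`. -/
def MemH1 (s t : ℝ) (u : ℝ → ℝ) : Prop :=
  MemL2 s t u ∧ ∃ g : ℝ → ℝ, MemL2 s t g ∧ HasWeakDeriv s t u g

/-- `u ∈ H¹₀(s, t)`: `u ∈ H¹(s, t)` and its continuous representative on `[s, t]`
vanishes at both end points. -/
def MemH10 (s t : ℝ) (u : ℝ → ℝ) : Prop :=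
  MemH1 s t u ∧ ∃ w : ℝ → ℝ, ContinuousOn w (Icc s t) ∧
    u =ᵐ[volume.restrict (Ioo s t)] w ∧ w s = 0 ∧ w t = 0

open Classical in
/-- The weak derivative in `L²(s, t)` of `u ∈ H¹(s, t)`; it is unique up to null sets.
The value `0` is used if `u` is not in `H¹(s, t)`. -/
def weakDeriv (s t : ℝ) (u : ℝ → ℝ) : ℝ → ℝ :=
  if h : ∃ g : ℝ → ℝ, MemL2 s t g ∧ HasWeakDeriv s t u g then h.choose else 0

/-- The norm of `L²(s, t)`. -/
def l2Norm (s t : ℝ) (u : ℝ → ℝ) : ℝ :=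
  √(∫ x in Ioo s t, u x ^ 2)

/-- The seminorm `|u|_{H¹(s, t)} = ‖u'‖_{L²(s, t)}`. -/
def h1Seminorm (s t : ℝ) (u : ℝ → ℝ) : ℝ :=
  l2Norm s t (weakDeriv s t u)

/-- The bilinear form `∫₀ᴸ A u' v' + b u' v`. -/
def advDiffForm (L : ℝ) (A : ℝ → ℝ) (b : ℝ) (u v : ℝ → ℝ) : ℝ :=
  ∫ x in Ioo 0 L, (A x * weakDeriv 0 L u x * weakDeriv 0 L v x + b * weakDeriv 0 L u x * v x)

/-- The linear form `∫₀ᴸ f v`. -/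
def loadForm (L : ℝ) (f v : ℝ → ℝ) : ℝ :=
  ∫ x in Ioo 0 L, f x * v x

/-- `u` is the weak solution in `H¹₀(0, L)` of `-(A u')' + b u' = f` in `(0, L)`,
`u(0) = u(L) = 0`. -/
def IsWeakSolution (L : ℝ) (A : ℝ → ℝ) (b : ℝ) (f u : ℝ → ℝ) : Prop :=
  MemH10 0 L u ∧ ∀ v : ℝ → ℝ, MemH10 0 L v → advDiffForm L A b u v = loadForm L f v

/-- A mesh `0 = x₀ < x₁ < ⋯ < x_N = L` of `(0, L)`, whose elements are the intervals
`(x_j, x_{j+1})`, `j < N`. The values `node j` for `j > N` play no role. -/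
structure Mesh (L : ℝ) where
  N : ℕ
  node : ℕ → ℝ
  node_zero : node 0 = 0
  node_last : node N = L
  node_lt : ∀ j < N, node j < node (j + 1)

/-- The mesh size: the length of the largest element. -/
def Mesh.size {L : ℝ} (T : Mesh L) : ℝ :=
  ⨆ j : Fin T.N, (T.node ((j : ℕ) + 1) - T.node (j : ℕ))

/-- The `ℙ¹` nodal basis (hat) function attached to the interior node `x_i`, `1 ≤ i < N`. -/
def Mesh.hat {L : ℝ} (T : Mesh L) (i : ℕ) (x : ℝ) : ℝ :=
  max 0 (min ((x - T.node (i - 1)) / (T.node i - T.node (i - 1)))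
    ((T.node (i + 1) - x) / (T.node (i + 1) - T.node i)))

/-- `ψ ∈ H¹₀(0, L)` is the (exact) multiscale basis function attached to the node `x_i`: on each
element `K`, it is the weak solution of `-(A ψ')' = 0` in `K`, with `ψ = hat i` on `∂K`. -/
def Mesh.IsBasisFunction {L : ℝ} (T : Mesh L) (A : ℝ → ℝ) (i : ℕ) (ψ : ℝ → ℝ) : Prop :=
  MemH10 0 L ψ ∧ ∀ j < T.N,
    MemH10 (T.node j) (T.node (j + 1)) (ψ - T.hat i) ∧
    ∀ v : ℝ → ℝ, MemH10 (T.node j) (T.node (j + 1)) v →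
      ∫ x in Ioo (T.node j) (T.node (j + 1)),
        A x * weakDeriv (T.node j) (T.node (j + 1)) ψ x *
          weakDeriv (T.node j) (T.node (j + 1)) v x = 0

/-- The multiscale finite element space: the span of the multiscale basis functions attached to
the interior nodes. -/
def Mesh.msSpace {L : ℝ} (T : Mesh L) (A : ℝ → ℝ) : Submodule ℝ (ℝ → ℝ) :=
  Submodule.span ℝ {ψ | ∃ i : ℕ, 1 ≤ i ∧ i < T.N ∧ T.IsBasisFunction A i ψ}

/-- `uH` is the MsFEM approximation: the Galerkin approximation, on the multiscale finite
element space and without stabilization, of `-(A u')' + b u' = f`, `u(0) = u(L) = 0`. -/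
def Mesh.IsMsFEMSolution {L : ℝ} (T : Mesh L) (A : ℝ → ℝ) (b : ℝ) (f uH : ℝ → ℝ) : Prop :=
  uH ∈ T.msSpace A ∧ ∀ v ∈ T.msSpace A, advDiffForm L A b uH v = loadForm L f v

end MsFEM

end

namespace MsFEM

/-! ### Square-integrable functions -/

/-! Let `v` be the element of the multiscale space that agrees with `u` at the nodes, `w = u - v`
and `e = u - uH`. Every `φ` in that space has `A φ'` constant on each element, while `w'` has mean
zero there, so `∫ A φ' w' = 0` (`Mesh.ElementwiseFlux.integral_eq_zero`). Moreover `‖w‖ ≤ H ‖w'‖` by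
Poincaré on each element (`Mesh.l2Norm_le_size_mul`).

Interpolation error: `∫ A w' w' = ∫ A u' w' = ∫ f w - b ∫ u' w`, hence `α₁ ‖w'‖ ≤ H (‖f‖ + |b|
‖u'‖)`.

Bound on `|b| ‖u'‖`: the energy estimate gives `α₁ ‖u'‖² ≤ ‖f‖ ‖u‖`, so `|b| ‖u‖` must be controlled
(`abs_mul_l2Norm_le`). Integrating the equation once, `A u' = b u + c - F` with `F` a primitive of
`f`. A comparison argument shows that `c - F` vanishes somewhere (`exists_flux_eq_zero`), so `|c -
F| ≤ √L ‖f‖`. Dividing by `A` and testing with `u` removes `u'`, since `∫ u' u = 0`.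

Galerkin error: put `z = v - uH`. Energy orthogonality gives `∫ A e' w' = ∫ A w' w'`. Galerkin
orthogonality and `∫ e' e = 0` give `∫ A e' z' = b ∫ e' w`. Thus `α₁ ‖e'‖² ≤ α₂ ‖w'‖² + |b| H ‖e'‖
‖w'‖`, a quadratic inequality in `‖e'‖` (`Mesh.l2Norm_error_le`).

Throughout, `H¹₀` functions are handled as primitives of mean-zero `L²` functions (`IsPrimitive`).
-/

theorem sq_integral_mul_le {α : Type*} [MeasurableSpace α] {μ : Measure α} {f g : α → ℝ}
    (hf : MemLp f 2 μ) (hg : MemLp g 2 μ) :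
    (∫ x, f x * g x ∂μ) ^ 2 ≤ (∫ x, f x ^ 2 ∂μ) * ∫ x, g x ^ 2 ∂μ := by
  have hfg : Integrable (fun x => f x * g x) μ := hf.integrable_mul hg
  have key : ∀ r : ℝ, 0 ≤ (∫ x, g x ^ 2 ∂μ) * (r * r) + (2 * ∫ x, f x * g x ∂μ) * r +
      ∫ x, f x ^ 2 ∂μ := by
    intro r
    have h : ∫ x, (f x + r * g x) ^ 2 ∂μ = (∫ x, g x ^ 2 ∂μ) * (r * r) +
        (2 * ∫ x, f x * g x ∂μ) * r + ∫ x, f x ^ 2 ∂μ := by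
      have e : (fun x => (f x + r * g x) ^ 2) =
          fun x => (r * r) * g x ^ 2 + (2 * r) * (f x * g x) + f x ^ 2 := by
        ext x; ring
      have hg2 := hg.integrable_sq.const_mul (r * r)
      have hfg2 := hfg.const_mul (2 * r)
      have h2 : Integrable (fun x => r * r * g x ^ 2 + 2 * r * (f x * g x)) μ := hg2.add hfg2
      rw [e, integral_add h2 hf.integrable_sq, integral_add hg2 hfg2,
        integral_const_mul, integral_const_mul]
      ring
    rw [← h]
    exact integral_nonneg fun x => sq_nonneg _
  have := discrim_le_zero key
  unfold discrim at this
  linarith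

theorem l2Norm_nonneg (s t : ℝ) (u : ℝ → ℝ) : 0 ≤ l2Norm s t u := Real.sqrt_nonneg _

theorem sq_l2Norm (s t : ℝ) (u : ℝ → ℝ) : l2Norm s t u ^ 2 = ∫ x in Ioo s t, u x ^ 2 :=
  Real.sq_sqrt (integral_nonneg fun _ => sq_nonneg _)

theorem l2Norm_congr {s t : ℝ} {u v : ℝ → ℝ} (h : u =ᵐ[volume.restrict (Ioo s t)] v) :
    l2Norm s t u = l2Norm s t v := by
  unfold l2Norm
  congr 1
  apply integral_congr_ae
  filter_upwards [h] with x hx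
  rw [hx]

theorem abs_integral_mul_le {s t : ℝ} {u v : ℝ → ℝ} (hu : MemL2 s t u) (hv : MemL2 s t v) :
    |∫ x in Ioo s t, u x * v x| ≤ l2Norm s t u * l2Norm s t v := by
  apply abs_le_of_sq_le_sq
  · rw [mul_pow, sq_l2Norm, sq_l2Norm]
    exact sq_integral_mul_le hu hv
  · exact mul_nonneg (l2Norm_nonneg _ _ _) (l2Norm_nonneg _ _ _)

theorem integral_mul_le {s t : ℝ} {u v : ℝ → ℝ} (hu : MemL2 s t u) (hv : MemL2 s t v) :
    ∫ x in Ioo s t, u x * v x ≤ l2Norm s t u * l2Norm s t v :=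
  (le_abs_self _).trans (abs_integral_mul_le hu hv)

theorem MemL2.integrableOn {s t : ℝ} {g : ℝ → ℝ} (hg : MemL2 s t g) : IntegrableOn g (Ioo s t) :=
  MemLp.integrable (by norm_num) hg

theorem MemL2.intervalIntegrable {s t : ℝ} {g : ℝ → ℝ} (hg : MemL2 s t g) (hst : s ≤ t) :
    IntervalIntegrable g volume s t := by
  rw [intervalIntegrable_iff_integrableOn_Ioo_of_le hst]
  exact hg.integrableOn

theorem MemL2.mono {s t p q : ℝ} {g : ℝ → ℝ} (hg : MemL2 s t g) (h : Ioo p q ⊆ Ioo s t) :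
    MemL2 p q g :=
  MemLp.mono_measure (Measure.restrict_mono h le_rfl) hg

theorem intervalIntegral_eq_Ioo {s t : ℝ} (hst : s ≤ t) (g : ℝ → ℝ) :
    ∫ x in s..t, g x = ∫ x in Ioo s t, g x := by
  rw [intervalIntegral.integral_of_le hst, integral_Ioc_eq_integral_Ioo]

/-! ### Primitives of square-integrable functions -/

theorem MemL2.continuousOn_primitive {s t : ℝ} {g : ℝ → ℝ} (hg : MemL2 s t g) (hst : s ≤ t) :
    ContinuousOn (fun x => ∫ y in s..x, g y) (Icc s t) := by
  have := ((hg.intervalIntegrable hst).absolutelyContinuousOnInterval_intervalIntegral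
    (left_mem_uIcc)).continuousOn
  rwa [uIcc_of_le hst] at this

theorem memL2_of_continuousOn {s t : ℝ} {g : ℝ → ℝ} (hg : ContinuousOn g (Icc s t)) :
    MemL2 s t g := by
  have h1 : IntegrableOn (fun x => g x ^ 2) (Ioo s t) :=
    ((hg.pow 2).integrableOn_Icc).mono_set Ioo_subset_Icc_self
  exact (memLp_two_iff_integrable_sq
    ((hg.mono Ioo_subset_Icc_self).aestronglyMeasurable measurableSet_Ioo)).2 h1

theorem MemL2.memL2_primitive {s t : ℝ} {g : ℝ → ℝ} (hg : MemL2 s t g) (hst : s ≤ t) :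
    MemL2 s t (fun x => ∫ y in s..x, g y) :=
  memL2_of_continuousOn (hg.continuousOn_primitive hst)

/-- The product rule for absolutely continuous functions. Derivatives are required only almost
everywhere, which is all that a primitive of an `L²` function offers. -/
theorem integral_mul_add_mul_of_primitive {s t : ℝ} (hst : s ≤ t) {f g F G : ℝ → ℝ}
    (hF : AbsolutelyContinuousOnInterval F s t) (hG : AbsolutelyContinuousOnInterval G s t)
    (hf : ∀ᵐ x, x ∈ Icc s t → HasDerivAt F (f x) x)
    (hg : ∀ᵐ x, x ∈ Icc s t → HasDerivAt G (g x) x) :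
    ∫ x in Ioo s t, (f x * G x + F x * g x) = F t * G t - F s * G s := by
  rw [← hF.integral_deriv_mul_eq_sub hG, intervalIntegral_eq_Ioo hst]
  apply setIntegral_congr_ae measurableSet_Ioo
  filter_upwards [hf, hg] with x hx hy hxm
  rw [(hx (Ioo_subset_Icc_self hxm)).deriv, (hy (Ioo_subset_Icc_self hxm)).deriv]

theorem ae_hasDerivAt_primitive {s t : ℝ} (hst : s ≤ t) {g : ℝ → ℝ}
    (hg : IntervalIntegrable g volume s t) :
    ∀ᵐ x, x ∈ Icc s t → HasDerivAt (fun x => ∫ y in s..x, g y) (g x) x := by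
  filter_upwards [hg.ae_hasDerivAt_integral] with x hx hxm
  rw [uIcc_of_le hst] at hx
  exact hx hxm s (left_mem_Icc.2 hst)

/-! ### Test functions and weak derivatives. -/

theorem IsTestFunction.eq_zero {s t : ℝ} {φ : ℝ → ℝ} (hφ : IsTestFunction s t φ) {x : ℝ}
    (hx : x ∉ Ioo s t) : φ x = 0 :=
  image_eq_zero_of_notMem_tsupport fun h => hx (hφ.2.2 h)

theorem IsTestFunction.absolutelyContinuousOnInterval {s t : ℝ} {φ : ℝ → ℝ}
    (hφ : IsTestFunction s t φ) : AbsolutelyContinuousOnInterval φ s t :=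
  (hφ.1.of_le (by simp)).contDiffOn.absolutelyContinuousOnInterval

theorem IsTestFunction.hasDerivAt {s t : ℝ} {φ : ℝ → ℝ}
    (hφ : IsTestFunction s t φ) (x : ℝ) : HasDerivAt φ (deriv φ x) x :=
  (hφ.1.differentiable (by simp)).differentiableAt.hasDerivAt

theorem IsTestFunction.memL2 {s t : ℝ} {φ : ℝ → ℝ} (hφ : IsTestFunction s t φ) : MemL2 s t φ :=
  memL2_of_continuousOn hφ.1.continuous.continuousOn

theorem IsTestFunction.memL2_deriv {s t : ℝ} {φ : ℝ → ℝ} (hφ : IsTestFunction s t φ) :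
    MemL2 s t (deriv φ) :=
  memL2_of_continuousOn (hφ.1.continuous_deriv (by simp)).continuousOn

theorem MemL2.integrable_mul {s t : ℝ} {f g : ℝ → ℝ} (hf : MemL2 s t f) (hg : MemL2 s t g) :
    Integrable (fun x => f x * g x) (volume.restrict (Ioo s t)) :=
  MemLp.integrable_mul hf hg

theorem HasWeakDeriv.congr {s t : ℝ} {u v g : ℝ → ℝ} (h : HasWeakDeriv s t u g)
    (huv : v =ᵐ[volume.restrict (Ioo s t)] u) : HasWeakDeriv s t v g := by
  intro φ hφ
  rw [← h φ hφ]
  apply integral_congr_ae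
  filter_upwards [huv] with x hx
  rw [hx]

theorem hasWeakDeriv_primitive {s t : ℝ} (hst : s ≤ t) {g : ℝ → ℝ} (hg : MemL2 s t g) :
    HasWeakDeriv s t (fun x => ∫ y in s..x, g y) g := by
  intro φ hφ
  have h := integral_mul_add_mul_of_primitive hst
    ((hg.intervalIntegrable hst).absolutelyContinuousOnInterval_intervalIntegral left_mem_uIcc)
    hφ.absolutelyContinuousOnInterval (ae_hasDerivAt_primitive hst (hg.intervalIntegrable hst))
    (Filter.Eventually.of_forall fun x _ => hφ.hasDerivAt x)
  rw [integral_add (hg.integrable_mul hφ.memL2)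
    ((hg.memL2_primitive hst).integrable_mul hφ.memL2_deriv), hφ.eq_zero (x := t) (by simp),
    hφ.eq_zero (x := s) (by simp)] at h
  linarith

theorem ae_eq_zero_of_integral_testFunction {s t : ℝ} {g : ℝ → ℝ} (hg : MemL2 s t g)
    (h : ∀ φ, IsTestFunction s t φ → ∫ x in Ioo s t, g x * φ x = 0) :
    g =ᵐ[volume.restrict (Ioo s t)] 0 := by
  have := isOpen_Ioo.ae_eq_zero_of_integral_contDiff_smul_eq_zero (μ := volume) (f := g)
    (U := Ioo s t) hg.integrableOn.locallyIntegrableOn (by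
      intro φ h1 h2 h3
      rw [← h φ ⟨h1, h2, h3⟩, ← setIntegral_eq_integral_of_forall_compl_eq_zero (s := Ioo s t)]
      · simp [mul_comm]
      · intro x hx
        rw [IsTestFunction.eq_zero ⟨h1, h2, h3⟩ hx, zero_smul])
  exact (ae_restrict_iff' measurableSet_Ioo).2 this

theorem HasWeakDeriv.unique {s t : ℝ} {u g h : ℝ → ℝ} (hg : MemL2 s t g) (hh : MemL2 s t h)
    (hug : HasWeakDeriv s t u g) (huh : HasWeakDeriv s t u h) :
    g =ᵐ[volume.restrict (Ioo s t)] h := by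
  have := ae_eq_zero_of_integral_testFunction (hg.sub hh) (by
    intro φ hφ
    have e : (fun x => (g - h) x * φ x) = fun x => g x * φ x - h x * φ x := by
      ext x; simp [sub_mul]
    rw [e, integral_sub (hg.integrable_mul hφ.memL2) (hh.integrable_mul hφ.memL2)]
    linarith [hug φ hφ, huh φ hφ])
  filter_upwards [this] with x hx
  exact sub_eq_zero.1 hx

theorem weakDeriv_ae_eq {s t : ℝ} {u g : ℝ → ℝ} (hg : MemL2 s t g)
    (hug : HasWeakDeriv s t u g) : weakDeriv s t u =ᵐ[volume.restrict (Ioo s t)] g := by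
  have h : ∃ g : ℝ → ℝ, MemL2 s t g ∧ HasWeakDeriv s t u g := ⟨g, hg, hug⟩
  unfold weakDeriv
  rw [dif_pos h]
  exact h.choose_spec.2.unique h.choose_spec.1 hg hug

/-- To the left of the support of `φ` the primitive is trivially zero; to its right it equals the
full integral, which vanishes. So the support does not grow beyond a compact interval inside `(s,
t)`. -/
theorem IsTestFunction.primitive {s t : ℝ} {φ : ℝ → ℝ} (hφ : IsTestFunction s t φ)
    (h0 : ∫ x in Ioo s t, φ x = 0) :
    IsTestFunction s t (fun x => ∫ y in s..x, φ y) ∧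
      ∀ x, deriv (fun x => ∫ y in s..x, φ y) x = φ x := by
  rcases lt_or_ge s t with hst | hst
  swap
  · have : φ = 0 := by
      ext x
      exact hφ.eq_zero (by simp [Ioo_eq_empty (not_lt.2 hst)])
    subst this
    have e : (fun x : ℝ => ∫ y in s..x, (0 : ℝ → ℝ) y) = 0 := by ext x; simp
    rw [e]
    exact ⟨hφ, fun x => by simp⟩
  have hd : ∀ x, HasDerivAt (fun x => ∫ y in s..x, φ y) (φ x) x := fun x =>
    intervalIntegral.integral_hasDerivAt_right (hφ.1.continuous.intervalIntegrable _ _)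
      (hφ.1.continuous.stronglyMeasurableAtFilter _ _) hφ.1.continuous.continuousAt
  have hd' : deriv (fun x => ∫ y in s..x, φ y) = φ := funext fun x => (hd x).deriv
  have hcd : ContDiff ℝ ∞ (fun x => ∫ y in s..x, φ y) := by
    rw [contDiff_infty_iff_deriv, hd']
    exact ⟨fun x => (hd x).differentiableAt, hφ.1⟩
  obtain ⟨p, q, hpq⟩ : ∃ p q, s < p ∧ q < t ∧ tsupport φ ⊆ Icc p q := by
    rcases (tsupport φ).eq_empty_or_nonempty with he | hne
    -- `p ≤ q` is never needed, so any `p > s` and `q < t` serve for an empty support.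
    · exact ⟨s + 1, t - 1, by linarith, by linarith, by simp [he]⟩
    · obtain ⟨p, hp, hp'⟩ := hφ.2.1.exists_isLeast hne
      obtain ⟨q, hq, hq'⟩ := hφ.2.1.exists_isGreatest hne
      exact ⟨p, q, (hφ.2.2 hp).1, (hφ.2.2 hq).2, fun x hx => ⟨hp' hx, hq' hx⟩⟩
  obtain ⟨hp, hq, hsub⟩ := hpq
  have hz : ∀ x, x ∉ Icc p q → φ x = 0 := fun x hx =>
    image_eq_zero_of_notMem_tsupport fun h => hx (hsub h)
  have hts : tsupport (fun x => ∫ y in s..x, φ y) ⊆ Icc p q := by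
    apply closure_minimal _ isClosed_Icc
    intro x hx
    by_contra hxn
    apply hx
    rw [mem_Icc, not_and_or, not_le, not_le] at hxn
    rcases hxn with h | h
    · have : ∫ y in s..x, φ y = ∫ y in s..x, (0 : ℝ) := by
        apply intervalIntegral.integral_congr
        intro y hy
        apply hz
        intro hy'
        have := hy.2
        have := max_lt hp h
        linarith [hy'.1]
      simpa using this
    · have h1 : ∫ y in x..t, φ y = ∫ y in x..t, (0 : ℝ) := by
        apply intervalIntegral.integral_congr
        intro y hy
        apply hz
        intro hy'
        have := hy.1
        have := lt_min h hq
        linarith [hy'.2]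
      have h2 := intervalIntegral.integral_add_adjacent_intervals
        (hφ.1.continuous.intervalIntegrable (μ := volume) s x)
        (hφ.1.continuous.intervalIntegrable x t)
      rw [intervalIntegral_eq_Ioo hst.le, h0, h1] at h2
      simpa using h2
  refine ⟨⟨hcd, ?_, ?_⟩, fun x => (hd x).deriv⟩
  · exact isCompact_Icc.of_isClosed_subset (isClosed_tsupport _) hts
  · exact hts.trans fun x hx => ⟨hp.trans_le hx.1, hx.2.trans_lt hq⟩

/-- Otherwise, after normalization, every test function would have integral zero, and the constant
`1` would vanish almost everywhere. -/
theorem exists_testFunction_integral_eq_one {s t : ℝ} (hst : s < t) :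
    ∃ η, IsTestFunction s t η ∧ ∫ x in Ioo s t, η x = 1 := by
  by_contra! hne
  have h := ae_eq_zero_of_integral_testFunction (s := s) (t := t) (g := fun _ => 1)
    (memL2_of_continuousOn continuousOn_const) (by
      intro φ hφ
      by_contra h0
      simp only [one_mul] at h0
      refine hne (fun x => (∫ x in Ioo s t, φ x)⁻¹ * φ x) ⟨?_, ?_, ?_⟩ ?_
      · exact contDiff_const.mul hφ.1
      · exact hφ.2.1.mul_left
      · exact (tsupport_mul_subset_right).trans hφ.2.2
      · rw [integral_const_mul, inv_mul_cancel₀ h0])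
  have h2 : ∀ᵐ x ∂(volume.restrict (Ioo s t)), False := by
    filter_upwards [h] with x hx
    simp at hx
  rw [Filter.eventually_false_iff_eq_bot, ae_eq_bot, Measure.restrict_eq_zero, Real.volume_Ioo] at h2
  simp at h2
  linarith

/-- Du Bois-Reymond: subtracting from `φ` the multiple of a fixed normalized `η` with the same
integral leaves the derivative of a test function, against which `u` integrates to zero. -/
theorem ae_eq_const_of_hasWeakDeriv_zero {s t : ℝ} (hst : s < t) {u : ℝ → ℝ} (hu : MemL2 s t u)
    (h : HasWeakDeriv s t u 0) : ∃ c : ℝ, u =ᵐ[volume.restrict (Ioo s t)] fun _ => c := by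
  obtain ⟨η, hη, hη1⟩ := exists_testFunction_integral_eq_one hst
  set c := ∫ x in Ioo s t, u x * η x with hc
  refine ⟨c, ?_⟩
  have hcL : MemL2 s t fun _ => c := memL2_of_continuousOn continuousOn_const
  have := ae_eq_zero_of_integral_testFunction (hu.sub hcL) (by
    intro φ hφ
    set m := ∫ x in Ioo s t, φ x with hm
    have hψ : IsTestFunction s t (fun x => φ x - m * η x) := by
      refine ⟨hφ.1.sub (contDiff_const.mul hη.1), hφ.2.1.sub hη.2.1.mul_left, ?_⟩
      exact (tsupport_sub _ _).trans
        (union_subset hφ.2.2 ((tsupport_mul_subset_right).trans hη.2.2))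
    have h0 : ∫ x in Ioo s t, (φ x - m * η x) = 0 := by
      rw [integral_sub hφ.memL2.integrableOn (hη.memL2.integrableOn.const_mul _),
        integral_const_mul, hη1, ← hm]
      ring
    obtain ⟨h1, h2⟩ := hψ.primitive h0
    have h3 := h _ h1
    simp only [h2, Pi.zero_apply, zero_mul, integral_zero, neg_zero] at h3
    have e : (fun x => u x * (φ x - m * η x)) = fun x => u x * φ x - m * (u x * η x) := by
      ext x; ring
    rw [e, integral_sub (hu.integrable_mul hφ.memL2) ((hu.integrable_mul hη.memL2).const_mul _),
      integral_const_mul, ← hc] at h3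
    have e' : (fun x => (u - (fun _ => c : ℝ → ℝ)) x * φ x) = fun x => u x * φ x - c * φ x := by
      ext x; simp only [Pi.sub_apply]; ring
    rw [e', integral_sub (hu.integrable_mul hφ.memL2) (hφ.memL2.integrableOn.const_mul _),
      integral_const_mul, ← hm]
    linarith)
  filter_upwards [this] with x hx
  exact sub_eq_zero.1 hx

/-! ### Characterization of `H¹₀` by primitives -/

/-- `g ∈ L²(s, t)` has mean zero, and `u` is its primitive vanishing at `s`, hence at `t`. -/
structure IsPrimitive (s t : ℝ) (u g : ℝ → ℝ) : Prop where
  memL2 : MemL2 s t g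
  ae_eq : u =ᵐ[volume.restrict (Ioo s t)] fun x => ∫ y in s..x, g y
  integral_eq_zero : ∫ x in Ioo s t, g x = 0

theorem IsPrimitive.hasWeakDeriv {s t : ℝ} {u g : ℝ → ℝ} (h : IsPrimitive s t u g) (hst : s ≤ t) :
    HasWeakDeriv s t u g :=
  (hasWeakDeriv_primitive hst h.memL2).congr h.ae_eq

theorem IsPrimitive.weakDeriv_ae_eq {s t : ℝ} {u g : ℝ → ℝ} (h : IsPrimitive s t u g)
    (hst : s ≤ t) : weakDeriv s t u =ᵐ[volume.restrict (Ioo s t)] g :=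
  MsFEM.weakDeriv_ae_eq h.memL2 (h.hasWeakDeriv hst)

theorem IsPrimitive.memL2_left {s t : ℝ} {u g : ℝ → ℝ} (h : IsPrimitive s t u g) (hst : s ≤ t) :
    MemL2 s t u :=
  (memLp_congr_ae h.ae_eq).2 (h.memL2.memL2_primitive hst)

theorem IsPrimitive.memH10 {s t : ℝ} {u g : ℝ → ℝ} (h : IsPrimitive s t u g) (hst : s ≤ t) :
    MemH10 s t u := by
  refine ⟨⟨h.memL2_left hst, g, h.memL2, h.hasWeakDeriv hst⟩, _,
    h.memL2.continuousOn_primitive hst, h.ae_eq, ?_, ?_⟩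
  · simp
  · rw [intervalIntegral_eq_Ioo hst, h.integral_eq_zero]

theorem eqOn_Icc_of_ae_eq {s t : ℝ} (hst : s < t) {v w : ℝ → ℝ} (hv : ContinuousOn v (Icc s t))
    (hw : ContinuousOn w (Icc s t)) (h : v =ᵐ[volume.restrict (Ioo s t)] w) :
    EqOn v w (Icc s t) := by
  have h1 : EqOn v w (Ioo s t) :=
    Measure.eqOn_open_of_ae_eq h isOpen_Ioo (hv.mono Ioo_subset_Icc_self)
      (hw.mono Ioo_subset_Icc_self)
  refine h1.of_subset_closure hv hw Ioo_subset_Icc_self ?_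
  rw [closure_Ioo hst.ne]

/-- `u` minus the primitive of its weak derivative is a constant. Comparing continuous
representatives, the boundary value at `s` makes the constant zero, and the one at `t` makes the
mean of `g` zero. -/
theorem MemH10.exists_isPrimitive {s t : ℝ} {u : ℝ → ℝ} (h : MemH10 s t u) (hst : s < t) :
    ∃ g, IsPrimitive s t u g := by
  obtain ⟨⟨hu, g, hg, hug⟩, w, hw, huw, hws, hwt⟩ := h
  have hG := hg.memL2_primitive hst.le
  have h0 : HasWeakDeriv s t (u - fun x => ∫ y in s..x, g y) 0 := by
    intro φ hφ
    have e : (fun x => (u - fun x => ∫ y in s..x, g y) x * deriv φ x) =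
        fun x => u x * deriv φ x - (∫ y in s..x, g y) * deriv φ x := by
      ext x; simp [sub_mul]
    rw [e, integral_sub (hu.integrable_mul hφ.memL2_deriv) (hG.integrable_mul hφ.memL2_deriv),
      hug φ hφ, hasWeakDeriv_primitive hst.le hg φ hφ]
    simp
  obtain ⟨c, hc⟩ := ae_eq_const_of_hasWeakDeriv_zero hst (hu.sub hG) h0
  have hGc := hg.continuousOn_primitive hst.le
  have hE := eqOn_Icc_of_ae_eq hst hw (hGc.add (continuousOn_const (c := c))) (by
    filter_upwards [huw, hc] with x hx hy
    simp only [Pi.sub_apply] at hy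
    simp only [Pi.add_apply]
    linarith)
  have hc0 : c = 0 := by
    have := hE (left_mem_Icc.2 hst.le)
    simp only [Pi.add_apply] at this
    simpa [hws] using this.symm
  have ht := hE (right_mem_Icc.2 hst.le)
  simp only [Pi.add_apply] at ht
  rw [hwt, hc0, intervalIntegral_eq_Ioo hst.le, add_zero] at ht
  refine ⟨g, hg, ?_, ht.symm⟩
  filter_upwards [hc] with x hx
  simp only [Pi.sub_apply, hc0] at hx
  linarith

theorem IsPrimitive.add {s t : ℝ} {u v g h : ℝ → ℝ} (hu : IsPrimitive s t u g)
    (hv : IsPrimitive s t v h) : IsPrimitive s t (u + v) (g + h) := by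
  refine ⟨hu.memL2.add hv.memL2, ?_, ?_⟩
  · filter_upwards [hu.ae_eq, hv.ae_eq, ae_restrict_mem measurableSet_Ioo] with x hx hy hxm
    have hs : Ioo s x ⊆ Ioo s t := Ioo_subset_Ioo_right hxm.2.le
    simp only [Pi.add_apply]
    rw [hx, hy, intervalIntegral.integral_add]
    · exact (hu.memL2.mono hs).intervalIntegrable hxm.1.le
    · exact (hv.memL2.mono hs).intervalIntegrable hxm.1.le
  · simp only [Pi.add_apply]
    rw [integral_add hu.memL2.integrableOn hv.memL2.integrableOn, hu.integral_eq_zero,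
      hv.integral_eq_zero, add_zero]

theorem IsPrimitive.const_smul {s t : ℝ} {u g : ℝ → ℝ} (hu : IsPrimitive s t u g) (c : ℝ) : IsPrimitive s t (c • u) (c • g) := by
  refine ⟨hu.memL2.const_smul c, ?_, ?_⟩
  · filter_upwards [hu.ae_eq] with x hx
    simp [hx]
  · simp only [Pi.smul_apply, smul_eq_mul]
    rw [integral_const_mul, hu.integral_eq_zero, mul_zero]

theorem IsPrimitive.sub {s t : ℝ} {u v g h : ℝ → ℝ} (hu : IsPrimitive s t u g)
    (hv : IsPrimitive s t v h) : IsPrimitive s t (u - v) (g - h) := by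
  have := hu.add (hv.const_smul (-1))
  simpa [sub_eq_add_neg] using this

theorem isPrimitive_zero (s t : ℝ) : IsPrimitive s t 0 0 :=
  ⟨MemLp.zero, by simp; rfl, by simp⟩

/-- `∫ u' u = 0` for `u ∈ H¹₀`. -/
theorem IsPrimitive.integral_mul_self {s t : ℝ} {u g : ℝ → ℝ} (hu : IsPrimitive s t u g)
    (hst : s ≤ t) : ∫ x in Ioo s t, g x * u x = 0 := by
  have hi := hu.memL2.intervalIntegrable hst
  have hac := hi.absolutelyContinuousOnInterval_intervalIntegral (c := s) left_mem_uIcc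
  have hd := ae_hasDerivAt_primitive hst hi
  have h := integral_mul_add_mul_of_primitive hst hac hac hd hd
  rw [intervalIntegral_eq_Ioo hst g, hu.integral_eq_zero] at h
  have e : ∫ x in Ioo s t, (g x * (∫ y in s..x, g y) + (∫ y in s..x, g y) * g x) =
      ∫ x in Ioo s t, 2 * (g x * u x) := by
    apply integral_congr_ae
    filter_upwards [hu.ae_eq] with x hx
    rw [hx]; ring
  rw [e, integral_const_mul] at h
  simp at h
  exact h

/-- Poincaré inequality for a function vanishing at the left end point. -/
theorem integral_sq_primitive_le {s t : ℝ} (hst : s ≤ t) {g : ℝ → ℝ} (hg : MemL2 s t g) :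
    ∫ x in Ioo s t, (∫ y in s..x, g y) ^ 2 ≤ (t - s) ^ 2 * ∫ x in Ioo s t, g x ^ 2 := by
  -- Cauchy–Schwarz against the constant `1` on `(s, x)`; integrating this uniform bound supplies
  -- the second factor `t - s`.
  have hb : ∀ x ∈ Ioo s t, (∫ y in s..x, g y) ^ 2 ≤ (t - s) * ∫ x in Ioo s t, g x ^ 2 := by
    intro x hx
    have hs : Ioo s x ⊆ Ioo s t := Ioo_subset_Ioo_right hx.2.le
    have h1 : MemL2 s x fun _ => (1 : ℝ) := memL2_of_continuousOn continuousOn_const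
    have h := sq_integral_mul_le h1 (hg.mono hs)
    simp only [one_mul, one_pow] at h
    rw [intervalIntegral_eq_Ioo hx.1.le]
    refine h.trans ?_
    have hm : ∫ x in Ioo s x, g x ^ 2 ≤ ∫ x in Ioo s t, g x ^ 2 :=
      setIntegral_mono_set (MemLp.integrable_sq hg)
        (Filter.Eventually.of_forall fun x => sq_nonneg _) hs.eventuallyLE
    have hl : ∫ _ in Ioo s x, (1 : ℝ) = x - s := by simp [hx.1.le]
    rw [hl]
    have : 0 ≤ ∫ x in Ioo s x, g x ^ 2 := integral_nonneg fun x => sq_nonneg _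
    exact mul_le_mul (by linarith [hx.2]) hm this (by linarith)
  calc ∫ x in Ioo s t, (∫ y in s..x, g y) ^ 2
      ≤ ∫ _ in Ioo s t, (t - s) * ∫ x in Ioo s t, g x ^ 2 :=
        setIntegral_mono_on (MemLp.integrable_sq (hg.memL2_primitive hst)) 
          (continuous_const.integrableOn_Icc.mono_set Ioo_subset_Icc_self)
          measurableSet_Ioo hb
    _ = _ := by simp [hst]; ring

/-! ### The bilinear form on `H¹₀` -/

theorem MemL2.bdd_mul {s t C : ℝ} {A g : ℝ → ℝ} (hg : MemL2 s t g)
    (hAm : AEMeasurable A (volume.restrict (Ioo s t)))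
    (hA : ∀ᵐ x ∂(volume.restrict (Ioo s t)), |A x| ≤ C) : MemL2 s t (fun x => A x * g x) := by
  refine MemLp.of_le_mul (c := C) hg (hAm.aestronglyMeasurable.mul hg.1) ?_
  filter_upwards [hA] with x hx
  rw [norm_mul]
  exact mul_le_mul_of_nonneg_right hx (norm_nonneg _)

/-- `A` is measurable on `(s, t)`, with values in `[α₁, α₂]`. -/
structure IsCoefficient (s t α₁ α₂ : ℝ) (A : ℝ → ℝ) : Prop where
  pos : 0 < α₁
  aemeasurable : AEMeasurable A (volume.restrict (Ioo s t))
  bounds : ∀ᵐ x ∂(volume.restrict (Ioo s t)), α₁ ≤ A x ∧ A x ≤ α₂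

theorem IsCoefficient.mono {s t p q α₁ α₂ : ℝ} {A : ℝ → ℝ} (hA : IsCoefficient s t α₁ α₂ A)
    (h : Ioo p q ⊆ Ioo s t) : IsCoefficient p q α₁ α₂ A :=
  ⟨hA.pos, hA.aemeasurable.mono_measure (Measure.restrict_mono h le_rfl),
    ae_restrict_of_ae_restrict_of_subset h hA.bounds⟩

theorem IsCoefficient.memL2_mul {s t α₁ α₂ : ℝ} {A g : ℝ → ℝ} (hA : IsCoefficient s t α₁ α₂ A)
    (hg : MemL2 s t g) : MemL2 s t (fun x => A x * g x) := by
  refine hg.bdd_mul (C := α₂) hA.aemeasurable ?_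
  filter_upwards [hA.bounds] with x hx
  rw [abs_of_pos (hA.pos.trans_le hx.1)]
  exact hx.2

theorem IsCoefficient.memL2_inv_mul {s t α₁ α₂ : ℝ} {A g : ℝ → ℝ}
    (hA : IsCoefficient s t α₁ α₂ A) (hg : MemL2 s t g) :
    MemL2 s t (fun x => (A x)⁻¹ * g x) := by
  refine hg.bdd_mul (C := α₁⁻¹) hA.aemeasurable.inv ?_
  filter_upwards [hA.bounds] with x hx
  rw [abs_of_pos (inv_pos.2 (hA.pos.trans_le hx.1))]
  exact inv_anti₀ hA.pos hx.1

theorem IsCoefficient.memL2_inv {s t α₁ α₂ : ℝ} {A : ℝ → ℝ}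
    (hA : IsCoefficient s t α₁ α₂ A) : MemL2 s t (fun x => (A x)⁻¹) := by
  have h : MemL2 s t fun _ => (1 : ℝ) := memL2_of_continuousOn continuousOn_const
  simpa using hA.memL2_inv_mul h

theorem IsCoefficient.mul_sq_l2Norm_le {s t α₁ α₂ : ℝ} {A g : ℝ → ℝ}
    (hA : IsCoefficient s t α₁ α₂ A) (hg : MemL2 s t g) :
    α₁ * l2Norm s t g ^ 2 ≤ ∫ x in Ioo s t, A x * g x * g x := by
  rw [sq_l2Norm, ← integral_const_mul]
  refine integral_mono_ae ((MemLp.integrable_sq hg).const_mul _)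
    ((hA.memL2_mul hg).integrable_mul hg) ?_
  filter_upwards [hA.bounds] with x hx
  nlinarith [sq_nonneg (g x), mul_nonneg (sub_nonneg.2 hx.1) (sq_nonneg (g x))]

theorem IsCoefficient.integral_le_mul_sq_l2Norm {s t α₁ α₂ : ℝ} {A g : ℝ → ℝ}
    (hA : IsCoefficient s t α₁ α₂ A) (hg : MemL2 s t g) :
    ∫ x in Ioo s t, A x * g x * g x ≤ α₂ * l2Norm s t g ^ 2 := by
  rw [sq_l2Norm, ← integral_const_mul]
  refine integral_mono_ae ((hA.memL2_mul hg).integrable_mul hg)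
    ((MemLp.integrable_sq hg).const_mul _) ?_
  filter_upwards [hA.bounds] with x hx
  nlinarith [sq_nonneg (g x), mul_nonneg (sub_nonneg.2 hx.2) (sq_nonneg (g x))]

/-- Replaces the chosen `weakDeriv` by explicit derivatives, with which it agrees almost everywhere.
-/
theorem advDiffForm_eq {L α₁ α₂ b : ℝ} (hL : 0 ≤ L) {A u v g h : ℝ → ℝ}
    (hA : IsCoefficient 0 L α₁ α₂ A) (hu : IsPrimitive 0 L u g) (hv : IsPrimitive 0 L v h) :
    advDiffForm L A b u v =
      (∫ x in Ioo 0 L, A x * g x * h x) + b * ∫ x in Ioo 0 L, g x * v x := by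
  rw [← integral_const_mul, ← integral_add ((hA.memL2_mul hu.memL2).integrable_mul hv.memL2)
    ((hu.memL2.integrable_mul (hv.memL2_left hL)).const_mul _)]
  apply integral_congr_ae
  filter_upwards [hu.weakDeriv_ae_eq hL, hv.weakDeriv_ae_eq hL] with x hx hy
  rw [hx, hy]
  ring

/-- Integration by parts, without boundary terms because `v` vanishes at both ends. It turns the
weak formulation into a statement about `v'` alone. -/
theorem IsPrimitive.integral_mul_eq_neg {s t : ℝ} {v h f : ℝ → ℝ} (hv : IsPrimitive s t v h)
    (hst : s ≤ t) (hf : MemL2 s t f) :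
    ∫ x in Ioo s t, f x * v x = -∫ x in Ioo s t, (∫ y in s..x, f y) * h x := by
  have hi := hv.memL2.intervalIntegrable hst
  have hj := hf.intervalIntegrable hst
  have key := integral_mul_add_mul_of_primitive hst
    (hj.absolutelyContinuousOnInterval_intervalIntegral (c := s) left_mem_uIcc)
    (hi.absolutelyContinuousOnInterval_intervalIntegral (c := s) left_mem_uIcc)
    (ae_hasDerivAt_primitive hst hj) (ae_hasDerivAt_primitive hst hi)
  rw [intervalIntegral_eq_Ioo hst h, hv.integral_eq_zero,
    integral_add (hf.integrable_mul (hv.memL2.memL2_primitive hst))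
    ((hf.memL2_primitive hst).integrable_mul hv.memL2)] at key
  have e : ∫ x in Ioo s t, f x * v x = ∫ x in Ioo s t, f x * ∫ y in s..x, h y := by
    apply integral_congr_ae
    filter_upwards [hv.ae_eq] with x hx
    rw [hx]
  simp only [intervalIntegral.integral_same] at key
  rw [e]
  linarith

/-- Take `η = k - c` with `c` the mean of `k`; then `∫ (k - c)² = 0`. -/
theorem ae_eq_const_of_integral_mul_eq_zero {s t : ℝ} (hst : s < t) {k : ℝ → ℝ}
    (hk : MemL2 s t k)
    (h : ∀ η, MemL2 s t η → ∫ x in Ioo s t, η x = 0 → ∫ x in Ioo s t, k x * η x = 0) :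
    ∃ c : ℝ, k =ᵐ[volume.restrict (Ioo s t)] fun _ => c := by
  set c := (∫ x in Ioo s t, k x) / (t - s) with hc
  have hts : t - s ≠ 0 := (sub_pos.2 hst).ne'
  have hcL : MemL2 s t fun _ => c := memL2_of_continuousOn continuousOn_const
  have hη : MemL2 s t fun x => k x - c := hk.sub hcL
  have h0 : ∫ x in Ioo s t, (k x - c) = 0 := by
    rw [integral_sub hk.integrableOn hcL.integrableOn]
    simp [hst.le, hc]
    field_simp
    ring
  have h1 := h _ hη h0
  have h2 : ∫ x in Ioo s t, (k x - c) ^ 2 = 0 := by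
    have e : (fun x => (k x - c) ^ 2) = fun x => k x * (k x - c) - c * (k x - c) := by
      ext x; ring
    rw [e, integral_sub (hk.integrable_mul hη) (hη.integrableOn.const_mul _), integral_const_mul,
      h0, h1]
    ring
  rw [integral_eq_zero_iff_of_nonneg (fun x => sq_nonneg _) (MemLp.integrable_sq hη)] at h2
  refine ⟨c, ?_⟩
  filter_upwards [h2] with x hx
  simp only [Pi.zero_apply, sq_eq_zero_iff] at hx
  linarith

/-! ### The flux of the exact solution -/

/-- The flux identity `A u' = b u + c - ∫ f`. -/
theorem exists_flux_eq {L α₁ α₂ b : ℝ} (hL : 0 < L) {A f u g : ℝ → ℝ}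
    (hA : IsCoefficient 0 L α₁ α₂ A) (hf : MemL2 0 L f) (hu : IsPrimitive 0 L u g)
    (hsol : IsWeakSolution L A b f u) :
    ∃ c : ℝ, ∀ᵐ x ∂(volume.restrict (Ioo 0 L)),
      A x * g x = b * (∫ y in (0 : ℝ)..x, g y) + (c - ∫ y in (0 : ℝ)..x, f y) := by
  have hG := hu.memL2.memL2_primitive hL.le
  have hF := hf.memL2_primitive hL.le
  have hAg := hA.memL2_mul hu.memL2
  have hk : MemL2 0 L fun x => A x * g x + (-b * (∫ y in (0 : ℝ)..x, g y) + ∫ y in (0 : ℝ)..x, f y) :=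
    hAg.add ((hG.const_mul (-b)).add hF)
  -- Every mean-zero `η` is the derivative of an `H¹₀` function, so the weak formulation says that
  -- `A u' - b u + F` is orthogonal to all such `η`.
  obtain ⟨c, hc⟩ := ae_eq_const_of_integral_mul_eq_zero hL hk (by
    intro η hη h0
    have hv : IsPrimitive 0 L (fun x => ∫ y in (0 : ℝ)..x, η y) η :=
      ⟨hη, Filter.EventuallyEq.rfl, h0⟩
    have h1 := hsol.2 _ (hv.memH10 hL.le)
    rw [advDiffForm_eq hL.le hA hu hv, loadForm, hv.integral_mul_eq_neg hL.le hf,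
      hv.integral_mul_eq_neg hL.le hu.memL2] at h1
    have e : (fun x => (A x * g x + (-b * (∫ y in (0 : ℝ)..x, g y) + ∫ y in (0 : ℝ)..x, f y)) * η x) =
        fun x => A x * g x * η x + (-b * ((∫ y in (0 : ℝ)..x, g y) * η x) +
          (∫ y in (0 : ℝ)..x, f y) * η x) := by
      ext x; ring
    have i1 := hAg.integrable_mul hη
    have i2 := (hG.integrable_mul hη).const_mul (-b)
    have i3 := hF.integrable_mul hη
    have i4 : Integrable (fun x => -b * ((∫ y in (0 : ℝ)..x, g y) * η x) +
          (∫ y in (0 : ℝ)..x, f y) * η x) (volume.restrict (Ioo 0 L)) := i2.add i3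
    rw [e, integral_add i1 i4, integral_add i2 i3, integral_const_mul]
    linarith)
  refine ⟨c, ?_⟩
  filter_upwards [hc] with x hx
  linarith

/-- A first-order equation `A U' = b U + G` with `G > 0` has no solution vanishing at both ends. -/
theorem not_flux_pos {L α₁ α₂ b : ℝ} (hL : 0 < L) {A g G : ℝ → ℝ}
    (hA : IsCoefficient 0 L α₁ α₂ A) (hg : MemL2 0 L g) (hg0 : ∫ x in Ioo 0 L, g x = 0)
    (hG : ContinuousOn G (Icc 0 L)) (hGpos : ∀ x ∈ Icc 0 L, 0 < G x)
    (heq : ∀ᵐ x ∂(volume.restrict (Ioo 0 L)), A x * g x = b * (∫ y in (0 : ℝ)..x, g y) + G x) :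
    False := by
  have hU := hg.continuousOn_primitive hL.le
  set U : ℝ → ℝ := fun x => ∫ y in (0 : ℝ)..x, g y with hUdef
  have hU0 : U 0 = 0 := by simp [hUdef]
  have hUL : U L = 0 := by simp only [hUdef]; rw [intervalIntegral_eq_Ioo hL.le, hg0]
  have hcont : ContinuousOn (fun x => b * U x + G x) (Icc 0 L) :=
    (continuousOn_const.mul hU).add hG
  have hmono : ∀ p q, 0 ≤ p → p ≤ q → q ≤ L → (∀ x ∈ Ioo p q, 0 < b * U x + G x) →
      U p ≤ U q := by
    intro p q hp hpq hq hpos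
    have hsub : Ioo p q ⊆ Ioo 0 L := Ioo_subset_Ioo hp hq
    have h1 : U q - U p = ∫ x in p..q, g x := by
      simp only [hUdef]
      rw [intervalIntegral.integral_interval_sub_left]
      · exact (hg.mono (Ioo_subset_Ioo_right hq)).intervalIntegrable (hp.trans hpq)
      · exact (hg.mono (Ioo_subset_Ioo_right (hpq.trans hq))).intervalIntegrable hp
    have h2 : 0 ≤ ∫ x in p..q, g x := by
      rw [intervalIntegral_eq_Ioo hpq]
      apply integral_nonneg_of_ae
      filter_upwards [ae_restrict_of_ae_restrict_of_subset hsub heq, (hA.mono hsub).bounds,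
        ae_restrict_mem measurableSet_Ioo] with x hx hxA hxm
      have := hpos x hxm
      rw [← hx] at this
      exact (pos_of_mul_pos_right this (hA.pos.trans_le hxA.1).le).le
    linarith
  -- `Z` is where the flux is not positive. If it is empty, `U' > 0` almost everywhere, against `U 0
  -- = U L`. If `b ≥ 0`, `U` increases from `0` up to the first point of `Z`, so `b U ≥ 0` there; if
  -- `b < 0`, `U` increases to `0` after the last point of `Z`, and again `b U ≥ 0` there. Either
  -- way `G > 0` contradicts membership in `Z`.
  set Z : Set ℝ := {x | x ∈ Icc 0 L ∧ b * U x + G x ∈ Iic 0} with hZ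
  have hZc : IsCompact Z :=
    isCompact_Icc.of_isClosed_subset (hcont.preimage_isClosed_of_isClosed isClosed_Icc isClosed_Iic)
      fun x hx => hx.1
  rcases Z.eq_empty_or_nonempty with he | hne
  · have hpos : ∀ x ∈ Icc 0 L, 0 < b * U x + G x := by
      intro x hx
      by_contra hn
      have : x ∈ Z := ⟨hx, not_lt.1 hn⟩
      simp [he] at this
    have hgp : ∀ᵐ x ∂(volume.restrict (Ioo 0 L)), 0 < g x := by
      filter_upwards [heq, hA.bounds, ae_restrict_mem measurableSet_Ioo] with x hx hxA hxm
      have := hpos x (Ioo_subset_Icc_self hxm)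
      rw [← hx] at this
      exact pos_of_mul_pos_right this (hA.pos.trans_le hxA.1).le
    rw [integral_eq_zero_iff_of_nonneg_ae (hgp.mono fun x hx => hx.le) hg.integrableOn] at hg0
    have h2 : ∀ᵐ x ∂(volume.restrict (Ioo 0 L)), False := by
      filter_upwards [hg0, hgp] with x hx hy
      simp only [Pi.zero_apply] at hx
      linarith
    rw [Filter.eventually_false_iff_eq_bot, ae_eq_bot, Measure.restrict_eq_zero,
      Real.volume_Ioo] at h2
    simp at h2
    linarith
  · rcases le_or_gt 0 b with hb | hb
    · obtain ⟨p, hp, hp'⟩ := hZc.exists_isLeast hne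
      have h1 := hmono 0 p le_rfl hp.1.1 hp.1.2 (by
        intro x hx
        by_contra hn
        exact absurd (hp' ⟨⟨hx.1.le, hx.2.le.trans hp.1.2⟩, not_lt.1 hn⟩) (not_le.2 hx.2))
      have h2 : b * U p + G p ≤ 0 := hp.2
      have := hGpos p hp.1
      rw [hU0] at h1
      nlinarith [mul_nonneg hb h1]
    · obtain ⟨p, hp, hp'⟩ := hZc.exists_isGreatest hne
      have h1 := hmono p L hp.1.1 hp.1.2 le_rfl (by
        intro x hx
        by_contra hn
        exact absurd (hp' ⟨⟨hp.1.1.trans hx.1.le, hx.2.le⟩, not_lt.1 hn⟩) (not_le.2 hx.1))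
      have h2 : b * U p + G p ≤ 0 := hp.2
      have := hGpos p hp.1
      rw [hUL] at h1
      nlinarith [mul_nonneg_of_nonpos_of_nonpos hb.le h1]

/-- Without a zero, the continuous `G` has constant sign; up to changing the signs of `g` and `G`,
this is the case excluded by `not_flux_pos`. -/
theorem exists_flux_eq_zero {L α₁ α₂ b : ℝ} (hL : 0 < L) {A g G : ℝ → ℝ}
    (hA : IsCoefficient 0 L α₁ α₂ A) (hg : MemL2 0 L g) (hg0 : ∫ x in Ioo 0 L, g x = 0)
    (hG : ContinuousOn G (Icc 0 L))
    (heq : ∀ᵐ x ∂(volume.restrict (Ioo 0 L)), A x * g x = b * (∫ y in (0 : ℝ)..x, g y) + G x) :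
    ∃ z ∈ Icc 0 L, G z = 0 := by
  by_contra! hne
  rcases lt_or_gt_of_ne (hne 0 (left_mem_Icc.2 hL.le)) with h0 | h0
  · refine not_flux_pos (b := b) (g := fun x => -g x) (G := fun x => -G x) hL hA hg.neg ?_ hG.neg
      ?_ ?_
    · rw [integral_neg, hg0, neg_zero]
    · intro x hx
      by_contra hn
      obtain ⟨z, hz, hz0⟩ := isPreconnected_Icc.intermediate_value (left_mem_Icc.2 hL.le) hx hG
        (show (0 : ℝ) ∈ Icc (G 0) (G x) from ⟨h0.le, by linarith⟩)
      exact hne z hz hz0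
    · filter_upwards [heq] with x hx
      rw [intervalIntegral.integral_neg]
      linarith
  · refine not_flux_pos (b := b) hL hA hg hg0 hG ?_ heq
    intro x hx
    by_contra hn
    obtain ⟨z, hz, hz0⟩ := isPreconnected_Icc.intermediate_value hx (left_mem_Icc.2 hL.le) hG
      (show (0 : ℝ) ∈ Icc (G x) (G 0) from ⟨by linarith, h0.le⟩)
    exact hne z hz hz0

theorem sq_primitive_sub_le {L : ℝ} (hL : 0 ≤ L) {f : ℝ → ℝ} (hf : MemL2 0 L f) {x z : ℝ}
    (hx : x ∈ Icc 0 L) (hz : z ∈ Icc 0 L) :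
    ((∫ y in (0 : ℝ)..z, f y) - ∫ y in (0 : ℝ)..x, f y) ^ 2 ≤ L * l2Norm 0 L f ^ 2 := by
  wlog hxz : x ≤ z generalizing x z
  · rw [← neg_sq, neg_sub]
    exact this hz hx (le_of_not_ge hxz)
  rw [intervalIntegral.integral_interval_sub_left
    ((hf.mono (Ioo_subset_Ioo_right hz.2)).intervalIntegrable hz.1)
    ((hf.mono (Ioo_subset_Ioo_right hx.2)).intervalIntegrable hx.1), intervalIntegral_eq_Ioo hxz]
  have hsub : Ioo x z ⊆ Ioo 0 L := Ioo_subset_Ioo hx.1 hz.2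
  have h1 : MemL2 x z fun _ => (1 : ℝ) := memL2_of_continuousOn continuousOn_const
  have h := sq_integral_mul_le h1 (hf.mono hsub)
  simp only [one_mul, one_pow] at h
  refine h.trans ?_
  have hl : ∫ _ in Ioo x z, (1 : ℝ) = z - x := by simp [hxz]
  have hm : ∫ x in Ioo x z, f x ^ 2 ≤ ∫ x in Ioo 0 L, f x ^ 2 :=
    setIntegral_mono_set (MemLp.integrable_sq hf)
      (Filter.Eventually.of_forall fun x => sq_nonneg _) hsub.eventuallyLE
  rw [hl, sq_l2Norm]
  exact mul_le_mul (by linarith [hx.1, hz.2]) hm (integral_nonneg fun x => sq_nonneg _) hL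

/-- The `L²` bound `|b| ‖u‖ ≤ (α₂ / α₁) L ‖f‖`. -/
theorem abs_mul_l2Norm_le {L α₁ α₂ b : ℝ} (hL : 0 < L) (hα : α₁ ≤ α₂) {A f u g : ℝ → ℝ}
    (hA : IsCoefficient 0 L α₁ α₂ A) (hf : MemL2 0 L f) (hu : IsPrimitive 0 L u g)
    (hsol : IsWeakSolution L A b f u) :
    |b| * l2Norm 0 L u ≤ α₂ / α₁ * L * l2Norm 0 L f := by
  have hα₁ := hA.pos
  have hα₂ : 0 < α₂ := hα₁.trans_le hα
  obtain ⟨c, hc⟩ := exists_flux_eq hL hA hf hu hsol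
  obtain ⟨z, hz, hz0⟩ := exists_flux_eq_zero hL hA hu.memL2 hu.integral_eq_zero
    (continuousOn_const.sub (hf.continuousOn_primitive hL.le)) hc
  simp only [Pi.sub_apply] at hz0
  -- The unknown integration constant becomes a value of the primitive of `f`, so the source `c - F`
  -- is an integral of `f` between two points.
  have hcz : c = ∫ y in (0 : ℝ)..z, f y := by linarith
  have huL := hu.memL2_left hL.le
  have hAu := hA.memL2_inv_mul huL
  -- By the flux identity `k = -(c - F) / A`, which is bounded in terms of `f`. Dividing by `A`
  -- leaves `u'` bare, so it disappears when `k` is tested with `u`.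
  set k : ℝ → ℝ := fun x => b * ((A x)⁻¹ * u x) - g x with hk
  have hkL : MemL2 0 L k := (hAu.const_mul b).sub hu.memL2
  have hkb : l2Norm 0 L k ≤ L * l2Norm 0 L f / α₁ := by
    have hF := l2Norm_nonneg 0 L f
    refine (sq_le_sq₀ (l2Norm_nonneg _ _ _) (by positivity)).1 ?_
    rw [sq_l2Norm]
    calc ∫ x in Ioo 0 L, k x ^ 2 ≤ ∫ _ in Ioo 0 L, L * l2Norm 0 L f ^ 2 / α₁ ^ 2 := by
          refine integral_mono_ae (MemLp.integrable_sq hkL)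
            (continuous_const.integrableOn_Icc.mono_set Ioo_subset_Icc_self) ?_
          filter_upwards [hc, hA.bounds, hu.ae_eq, ae_restrict_mem measurableSet_Ioo]
            with x hx hxA hxu hxm
          have hAx : 0 < A x := hα₁.trans_le hxA.1
          have hkx : k x = -(((∫ y in (0 : ℝ)..z, f y) - ∫ y in (0 : ℝ)..x, f y) / A x) := by
            simp only [hk]
            rw [hxu, ← hcz]
            field_simp
            linarith
          have h1 := sq_primitive_sub_le hL.le hf (Ioo_subset_Icc_self hxm) hz
          change k x ^ 2 ≤ _
          rw [hkx, neg_sq, div_pow]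
          have : 0 ≤ L * l2Norm 0 L f ^ 2 := by positivity
          have h2 : α₁ ^ 2 ≤ A x ^ 2 := pow_le_pow_left₀ hα₁.le hxA.1 2
          exact div_le_div₀ this h1 (by positivity) h2
      _ = (L * l2Norm 0 L f / α₁) ^ 2 := by
          simp [hL.le]
          ring
  have h1 : ∫ x in Ioo 0 L, k x * u x = b * ∫ x in Ioo 0 L, (A x)⁻¹ * u x * u x := by
    have e : (fun x => k x * u x) = fun x => b * ((A x)⁻¹ * u x * u x) - g x * u x := by
      ext x; simp only [hk]; ring
    rw [e, integral_sub ((hAu.integrable_mul huL).const_mul b) (hu.memL2.integrable_mul huL),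
      integral_const_mul, hu.integral_mul_self hL.le, sub_zero]
  have h2 : α₂⁻¹ * l2Norm 0 L u ^ 2 ≤ ∫ x in Ioo 0 L, (A x)⁻¹ * u x * u x := by
    rw [sq_l2Norm, ← integral_const_mul]
    refine integral_mono_ae ((MemLp.integrable_sq huL).const_mul _) (hAu.integrable_mul huL) ?_
    filter_upwards [hA.bounds] with x hx
    have : α₂⁻¹ ≤ (A x)⁻¹ := inv_anti₀ (hα₁.trans_le hx.1) hx.2
    nlinarith [mul_nonneg (sub_nonneg.2 this) (sq_nonneg (u x))]
  have h3 := abs_integral_mul_le hkL huL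
  rw [h1, abs_mul] at h3
  have hU := l2Norm_nonneg 0 L u
  have h4 : |b| * (α₂⁻¹ * l2Norm 0 L u ^ 2) ≤ L * l2Norm 0 L f / α₁ * l2Norm 0 L u :=
    (mul_le_mul_of_nonneg_left (h2.trans (le_abs_self _)) (abs_nonneg b)).trans
      (h3.trans (mul_le_mul_of_nonneg_right hkb hU))
  rcases hU.eq_or_lt with h0 | h0
  · rw [← h0, mul_zero]
    have := l2Norm_nonneg 0 L f
    positivity
  · have h5 : |b| * l2Norm 0 L u * (α₂⁻¹ * l2Norm 0 L u) ≤
        α₂ / α₁ * L * l2Norm 0 L f * (α₂⁻¹ * l2Norm 0 L u) := by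
      calc _ = |b| * (α₂⁻¹ * l2Norm 0 L u ^ 2) := by ring
        _ ≤ _ := h4
        _ = _ := by field_simp
    exact le_of_mul_le_mul_right h5 (by positivity)

/-- The a priori bound on `|b| |u|_{H¹}`. -/
theorem abs_mul_l2Norm_deriv_le {L α₁ α₂ b : ℝ} (hL : 0 < L) (hα : α₁ ≤ α₂) {A f u g : ℝ → ℝ}
    (hA : IsCoefficient 0 L α₁ α₂ A) (hf : MemL2 0 L f) (hu : IsPrimitive 0 L u g)
    (hsol : IsWeakSolution L A b f u) :
    |b| * l2Norm 0 L g ≤ √(2 * α₂ * L * |b|) / α₁ * l2Norm 0 L f := by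
  have hα₁ := hA.pos
  have hα₂ : 0 < α₂ := hα₁.trans_le hα
  have hF := l2Norm_nonneg 0 L f
  have h1 := hsol.2 u (hu.memH10 hL.le)
  rw [advDiffForm_eq hL.le hA hu hu, hu.integral_mul_self hL.le, mul_zero, add_zero, loadForm] at h1
  have h2 : α₁ * l2Norm 0 L g ^ 2 ≤ l2Norm 0 L f * l2Norm 0 L u :=
    (hA.mul_sq_l2Norm_le hu.memL2).trans (h1 ▸ integral_mul_le hf (hu.memL2_left hL.le))
  have h3 := abs_mul_l2Norm_le hL hα hA hf hu hsol
  have hg := l2Norm_nonneg 0 L g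
  refine (sq_le_sq₀ (by positivity) (by positivity)).1 ?_
  rw [mul_pow, mul_pow, div_pow, Real.sq_sqrt (by positivity)]
  have h4 : α₁ * (|b| ^ 2 * l2Norm 0 L g ^ 2) ≤
      α₁ * (α₂ * L * |b| / α₁ ^ 2 * l2Norm 0 L f ^ 2) := by
    calc _ = |b| ^ 2 * (α₁ * l2Norm 0 L g ^ 2) := by ring
      _ ≤ |b| ^ 2 * (l2Norm 0 L f * l2Norm 0 L u) := by gcongr
      _ = |b| * l2Norm 0 L f * (|b| * l2Norm 0 L u) := by ring
      _ ≤ |b| * l2Norm 0 L f * (α₂ / α₁ * L * l2Norm 0 L f) := by gcongr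
      _ = _ := by field_simp
  -- The argument gives `α₂ L |b|` under the root; the factor `2` is slack.
  refine (le_of_mul_le_mul_left h4 hα₁).trans ?_
  gcongr
  have : 0 ≤ α₂ * L * |b| := by positivity
  linarith

/-! ### Meshes -/

theorem Mesh.node_le_node {L : ℝ} (T : Mesh L) {i j : ℕ} (hij : i ≤ j) (hj : j ≤ T.N) :
    T.node i ≤ T.node j := by
  induction j, hij using Nat.le_induction with
  | base => exact le_rfl
  | succ k hk ih => exact (ih (by omega)).trans (T.node_lt k (by omega)).le

theorem Mesh.node_mem_Icc {L : ℝ} (T : Mesh L) {j : ℕ} (hj : j ≤ T.N) :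
    T.node j ∈ Icc 0 L := by
  constructor
  · exact T.node_zero.symm.trans_le (T.node_le_node (Nat.zero_le _) hj)
  · exact (T.node_le_node hj le_rfl).trans_eq T.node_last

theorem Mesh.Ioo_subset {L : ℝ} (T : Mesh L) {j : ℕ} (hj : j < T.N) :
    Ioo (T.node j) (T.node (j + 1)) ⊆ Ioo 0 L :=
  Ioo_subset_Ioo (T.node_mem_Icc hj.le).1 (T.node_mem_Icc hj).2

theorem Mesh.eq_of_mem_Ioo {L : ℝ} (T : Mesh L) {j k : ℕ} (hj : j < T.N) (hk : k < T.N) {x : ℝ}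
    (hxj : x ∈ Ioo (T.node j) (T.node (j + 1))) (hxk : x ∈ Ioo (T.node k) (T.node (k + 1))) :
    j = k := by
  rcases lt_trichotomy j k with h | h | h
  · have := T.node_le_node (show j + 1 ≤ k by omega) hk.le
    linarith [hxj.2, hxk.1]
  · exact h
  · have := T.node_le_node (show k + 1 ≤ j by omega) hj.le
    linarith [hxj.1, hxk.2]

theorem Mesh.length_le_size {L : ℝ} (T : Mesh L) {j : ℕ} (hj : j < T.N) :
    T.node (j + 1) - T.node j ≤ T.size :=
  le_ciSup (f := fun j : Fin T.N => T.node ((j : ℕ) + 1) - T.node (j : ℕ))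
    (finite_range _).bddAbove ⟨j, hj⟩

theorem Mesh.size_nonneg {L : ℝ} (T : Mesh L) : 0 ≤ T.size :=
  Real.iSup_nonneg fun j => (sub_pos.2 (T.node_lt j j.2)).le

theorem Mesh.sum_integral {L : ℝ} (hL : 0 ≤ L) (T : Mesh L) {g : ℝ → ℝ}
    (hg : IntegrableOn g (Ioo 0 L)) :
    ∑ j ∈ Finset.range T.N, ∫ x in Ioo (T.node j) (T.node (j + 1)), g x = ∫ x in Ioo 0 L, g x := by
  have h := intervalIntegral.sum_integral_adjacent_intervals (μ := volume) (f := g) (a := T.node)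
    (n := T.N) (by
      intro k hk
      rw [intervalIntegrable_iff_integrableOn_Ioo_of_le (T.node_lt k hk).le]
      exact hg.mono_set (T.Ioo_subset hk))
  rw [T.node_zero, T.node_last, intervalIntegral_eq_Ioo hL] at h
  rw [← h]
  apply Finset.sum_congr rfl
  intro j hj
  rw [intervalIntegral_eq_Ioo (T.node_lt j (Finset.mem_range.1 hj)).le]

theorem Mesh.primitive_node_succ {L : ℝ} (T : Mesh L) {g : ℝ → ℝ} (hg : MemL2 0 L g) {j : ℕ}
    (hj : j < T.N) {x : ℝ} (hx : x ∈ Icc (T.node j) (T.node (j + 1))) :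
    ∫ y in (0 : ℝ)..x, g y = (∫ y in (0 : ℝ)..T.node j, g y) + ∫ y in T.node j..x, g y := by
  have hj0 := T.node_mem_Icc hj.le
  have hj1 := T.node_mem_Icc (Nat.succ_le_of_lt hj)
  rw [intervalIntegral.integral_add_adjacent_intervals]
  · exact (hg.mono (Ioo_subset_Ioo_right hj0.2)).intervalIntegrable hj0.1
  · exact (hg.mono (Ioo_subset_Ioo hj0.1 (hx.2.trans hj1.2))).intervalIntegrable hx.1

/-- Poincaré inequality for functions vanishing at the nodes of the mesh. -/
theorem Mesh.l2Norm_le_size_mul {L : ℝ} (hL : 0 ≤ L) (T : Mesh L) {w g : ℝ → ℝ}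
    (hw : IsPrimitive 0 L w g) (hn : ∀ j ≤ T.N, ∫ y in (0 : ℝ)..T.node j, g y = 0) :
    l2Norm 0 L w ≤ T.size * l2Norm 0 L g := by
  refine (sq_le_sq₀ (l2Norm_nonneg _ _ _)
    (mul_nonneg T.size_nonneg (l2Norm_nonneg _ _ _))).1 ?_
  rw [l2Norm_congr hw.ae_eq, mul_pow, sq_l2Norm, sq_l2Norm,
    ← T.sum_integral hL (MemLp.integrable_sq (hw.memL2.memL2_primitive hL)),
    ← T.sum_integral hL (MemLp.integrable_sq hw.memL2), Finset.mul_sum]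
  apply Finset.sum_le_sum
  intro j hj
  have hj := Finset.mem_range.1 hj
  have hlt := T.node_lt j hj
  have e : ∫ x in Ioo (T.node j) (T.node (j + 1)), (∫ y in (0 : ℝ)..x, g y) ^ 2 =
      ∫ x in Ioo (T.node j) (T.node (j + 1)), (∫ y in T.node j..x, g y) ^ 2 := by
    apply setIntegral_congr_fun measurableSet_Ioo
    intro x hx
    change (∫ y in (0 : ℝ)..x, g y) ^ 2 = (∫ y in T.node j..x, g y) ^ 2
    rw [T.primitive_node_succ hw.memL2 hj (Ioo_subset_Icc_self hx), hn j hj.le, zero_add]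
  rw [e]
  refine (integral_sq_primitive_le hlt.le (hw.memL2.mono (T.Ioo_subset hj))).trans ?_
  have h0 : 0 ≤ T.node (j + 1) - T.node j := (sub_pos.2 hlt).le
  have := T.length_le_size hj
  have : 0 ≤ ∫ x in Ioo (T.node j) (T.node (j + 1)), g x ^ 2 := integral_nonneg fun x => sq_nonneg _
  gcongr

/-! ### The multiscale space -/

/-- A test function on the smaller interval is one on the larger, and both integrands vanish outside
the smaller. -/
theorem HasWeakDeriv.mono {s t p q : ℝ} {u g : ℝ → ℝ} (h : HasWeakDeriv s t u g)
    (hsub : Ioo p q ⊆ Ioo s t) : HasWeakDeriv p q u g := by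
  intro φ hφ
  have hφ' : IsTestFunction s t φ := ⟨hφ.1, hφ.2.1, hφ.2.2.trans hsub⟩
  have hd : ∀ x, x ∉ Ioo p q → deriv φ x = 0 := fun x hx => by
    by_contra hne
    exact hx (hφ.2.2 (support_deriv_subset hne))
  have key := h φ hφ'
  rw [setIntegral_eq_of_subset_of_forall_sdiff_eq_zero measurableSet_Ioo hsub
      (fun x hx => by rw [hd x hx.2, mul_zero]),
    setIntegral_eq_of_subset_of_forall_sdiff_eq_zero measurableSet_Ioo hsub
      (fun x hx => by rw [hφ.eq_zero hx.2, mul_zero])] at key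
  exact key

/-- `∫_K A γ η = 0` for each element `K` and each `η ∈ L²(K)` of mean zero; that is, `A γ` is
constant in each element. -/
def Mesh.ElementwiseFlux {L : ℝ} (T : Mesh L) (A γ : ℝ → ℝ) : Prop :=
  ∀ j < T.N, ∀ η : ℝ → ℝ, MemL2 (T.node j) (T.node (j + 1)) η →
    ∫ x in Ioo (T.node j) (T.node (j + 1)), η x = 0 →
    ∫ x in Ioo (T.node j) (T.node (j + 1)), A x * γ x * η x = 0

theorem Mesh.ElementwiseFlux.add {L α₁ α₂ : ℝ} {T : Mesh L} {A g h : ℝ → ℝ}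
    (hA : IsCoefficient 0 L α₁ α₂ A) (hg : MemL2 0 L g) (hh : MemL2 0 L h)
    (h1 : T.ElementwiseFlux A g) (h2 : T.ElementwiseFlux A h) : T.ElementwiseFlux A (g + h) := by
  intro j hj η hη h0
  have e : (fun x => A x * (g + h) x * η x) = fun x => A x * g x * η x + A x * h x * η x := by
    ext x; simp only [Pi.add_apply]; ring
  have hsub := T.Ioo_subset hj
  rw [e, integral_add (((hA.memL2_mul hg).mono hsub).integrable_mul hη)
    (((hA.memL2_mul hh).mono hsub).integrable_mul hη), h1 j hj η hη h0, h2 j hj η hη h0, add_zero]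

theorem Mesh.ElementwiseFlux.const_smul {L : ℝ} {T : Mesh L} {A g : ℝ → ℝ}
    (h1 : T.ElementwiseFlux A g) (c : ℝ) : T.ElementwiseFlux A (c • g) := by
  intro j hj η hη h0
  have e : (fun x => A x * (c • g) x * η x) = fun x => c * (A x * g x * η x) := by
    ext x; simp only [Pi.smul_apply, smul_eq_mul]; ring
  rw [e, integral_const_mul, h1 j hj η hη h0, mul_zero]

/-- The energy orthogonality behind the method: a primitive vanishing at the nodes forces `η` to
have mean zero on each element. -/
theorem Mesh.ElementwiseFlux.integral_eq_zero {L α₁ α₂ : ℝ} (hL : 0 ≤ L) {T : Mesh L}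
    {A g η : ℝ → ℝ} (hA : IsCoefficient 0 L α₁ α₂ A) (hg : MemL2 0 L g) (hη : MemL2 0 L η)
    (h : T.ElementwiseFlux A g) (hn : ∀ j ≤ T.N, ∫ y in (0 : ℝ)..T.node j, η y = 0) :
    ∫ x in Ioo 0 L, A x * g x * η x = 0 := by
  rw [← T.sum_integral hL ((hA.memL2_mul hg).integrable_mul hη)]
  apply Finset.sum_eq_zero
  intro j hj
  have hj := Finset.mem_range.1 hj
  have hlt := T.node_lt j hj
  refine h j hj η (hη.mono (T.Ioo_subset hj)) ?_
  have := T.primitive_node_succ hη hj (right_mem_Icc.2 hlt.le)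
  rw [hn j hj.le, hn (j + 1) hj, zero_add, intervalIntegral_eq_Ioo hlt.le] at this
  exact this.symm

/-- On an element, the primitive of a mean-zero `η` is an admissible test function in the local
problem, and the local weak derivative of `ψ` is the restriction of the global one. -/
theorem Mesh.IsBasisFunction.exists_isPrimitive {L : ℝ} (hL : 0 < L) {T : Mesh L}
    {A ψ : ℝ → ℝ} {i : ℕ} (h : T.IsBasisFunction A i ψ) :
    ∃ γ, IsPrimitive 0 L ψ γ ∧ T.ElementwiseFlux A γ := by
  obtain ⟨γ, hγ⟩ := h.1.exists_isPrimitive hL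
  refine ⟨γ, hγ, fun j hj η hη h0 => ?_⟩
  have hlt := T.node_lt j hj
  have hv : IsPrimitive (T.node j) (T.node (j + 1)) (fun x => ∫ y in T.node j..x, η y) η :=
    ⟨hη, Filter.EventuallyEq.rfl, h0⟩
  rw [← (h.2 j hj).2 _ (hv.memH10 hlt.le)]
  have hw := weakDeriv_ae_eq (hγ.memL2.mono (T.Ioo_subset hj))
    ((hγ.hasWeakDeriv hL.le).mono (T.Ioo_subset hj))
  apply integral_congr_ae
  filter_upwards [hw, hv.weakDeriv_ae_eq hlt.le] with x hx hy
  rw [hx, hy]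

theorem Mesh.exists_isPrimitive_of_mem_msSpace {L α₁ α₂ : ℝ} (hL : 0 < L) {T : Mesh L}
    {A v : ℝ → ℝ} (hA : IsCoefficient 0 L α₁ α₂ A) (hv : v ∈ T.msSpace A) :
    ∃ γ, IsPrimitive 0 L v γ ∧ T.ElementwiseFlux A γ := by
  induction hv using Submodule.span_induction with
  | mem ψ hψ =>
    obtain ⟨i, -, -, hψ⟩ := hψ
    exact hψ.exists_isPrimitive hL
  | zero => exact ⟨0, isPrimitive_zero 0 L, fun j _ η _ _ => by simp⟩
  | add u v _ _ hu hv =>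
    obtain ⟨g, hg, hg'⟩ := hu
    obtain ⟨h, hh, hh'⟩ := hv
    exact ⟨g + h, hg.add hh, hg'.add hA hg.memL2 hh.memL2 hh'⟩
  | smul c u _ hu =>
    obtain ⟨g, hg, hg'⟩ := hu
    exact ⟨c • g, hg.const_smul c, hg'.const_smul c⟩

theorem Mesh.elementwiseFlux_of_mem_msSpace {L α₁ α₂ : ℝ} (hL : 0 < L) {T : Mesh L}
    {A v γ : ℝ → ℝ} (hA : IsCoefficient 0 L α₁ α₂ A) (hv : v ∈ T.msSpace A)
    (hγ : IsPrimitive 0 L v γ) : T.ElementwiseFlux A γ := by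
  obtain ⟨g, hg, hg'⟩ := Mesh.exists_isPrimitive_of_mem_msSpace hL hA hv
  have hgγ := (hg.weakDeriv_ae_eq hL.le).symm.trans (hγ.weakDeriv_ae_eq hL.le)
  intro j hj η hη h0
  rw [← hg' j hj η hη h0]
  apply integral_congr_ae
  filter_upwards [ae_restrict_of_ae_restrict_of_subset (T.Ioo_subset hj) hgγ] with x hx
  rw [hx]

/-! ### Existence of the multiscale basis functions -/

/-- There is a function with prescribed nodal values and elementwise constant flux. -/
theorem Mesh.exists_nodal_values {L α₁ α₂ : ℝ} (T : Mesh L) {A : ℝ → ℝ}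
    (hA : IsCoefficient 0 L α₁ α₂ A) (d : ℕ → ℝ) (hd : d 0 = 0) :
    ∃ γ, MemL2 0 L γ ∧
      (∀ j < T.N, ∃ c : ℝ, ∀ x ∈ Ioo (T.node j) (T.node (j + 1)), γ x = c * (A x)⁻¹) ∧
      ∀ j ≤ T.N, ∫ y in (0 : ℝ)..T.node j, γ y = d j := by
  set R : ℕ → ℝ := fun j => ∫ x in Ioo (T.node j) (T.node (j + 1)), (A x)⁻¹ with hR
  have hRpos : ∀ j < T.N, 0 < R j := by
    intro j hj
    have hAj := hA.mono (T.Ioo_subset hj)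
    have hlt := T.node_lt j hj
    have hge : 0 ≤ᵐ[volume.restrict (Ioo (T.node j) (T.node (j + 1)))] fun x => (A x)⁻¹ := by
      filter_upwards [hAj.bounds] with x hx
      exact (inv_pos.2 (hA.pos.trans_le hx.1)).le
    refine lt_of_le_of_ne (integral_nonneg_of_ae hge) fun h0 => ?_
    have h1 := (integral_eq_zero_iff_of_nonneg_ae hge hAj.memL2_inv.integrableOn).1 h0.symm
    have h2 : ∀ᵐ x ∂(volume.restrict (Ioo (T.node j) (T.node (j + 1)))), False := by
      filter_upwards [h1, hAj.bounds] with x hx hxA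
      exact (inv_pos.2 (hA.pos.trans_le hxA.1)).ne' hx
    rw [Filter.eventually_false_iff_eq_bot, ae_eq_bot, Measure.restrict_eq_zero,
      Real.volume_Ioo] at h2
    simp at h2
    linarith
  -- Constant flux on an element means `γ = c / A` there; the increment `d (j + 1) - d j` fixes `c`,
  -- with `R j > 0` the integral of `1 / A`.
  set γ : ℝ → ℝ := fun x => ∑ j ∈ Finset.range T.N,
    (Ioo (T.node j) (T.node (j + 1))).indicator
      (fun x => (d (j + 1) - d j) / R j * (A x)⁻¹) x with hγ
  have hγK : ∀ j < T.N, ∀ x ∈ Ioo (T.node j) (T.node (j + 1)),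
      γ x = (d (j + 1) - d j) / R j * (A x)⁻¹ := by
    intro j hj x hx
    simp only [hγ]
    rw [Finset.sum_eq_single j]
    · rw [indicator_of_mem hx]
    · intro k hk hkj
      exact indicator_of_notMem
        (fun hxk => hkj (T.eq_of_mem_Ioo (Finset.mem_range.1 hk) hj hxk hx)) _
    · intro h
      exact absurd (Finset.mem_range.2 hj) h
  have hγL : MemL2 0 L γ :=
    memLp_finsetSum _ fun j _ => (hA.memL2_inv.const_mul _).indicator measurableSet_Ioo
  refine ⟨γ, hγL, fun j hj => ⟨_, hγK j hj⟩, fun j => ?_⟩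
  induction j with
  | zero => intro _; simp [T.node_zero, hd]
  | succ j ih =>
    intro hj
    have hlt := T.node_lt j hj
    rw [T.primitive_node_succ hγL hj (right_mem_Icc.2 hlt.le), ih (by omega),
      intervalIntegral_eq_Ioo hlt.le, setIntegral_congr_fun measurableSet_Ioo (hγK j hj),
      integral_const_mul, div_mul_cancel₀ _ (hRpos j hj).ne']
    ring

theorem Mesh.hat_eq {L : ℝ} (T : Mesh L) {i j : ℕ} (hi : 1 ≤ i) (hiN : i < T.N) (hj : j < T.N)
    {x : ℝ} (hx : x ∈ Ioo (T.node j) (T.node (j + 1))) :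
    T.hat i x = (if j = i then 1 else 0) +
      ((if j + 1 = i then 1 else 0) - (if j = i then 1 else 0)) /
        (T.node (j + 1) - T.node j) * (x - T.node j) := by
  -- Removes the truncated subtraction `i - 1`. The hat is then nonzero only on elements `k` and `k
  -- + 1`.
  obtain ⟨k, rfl⟩ : ∃ k, i = k + 1 := ⟨i - 1, by omega⟩
  have hk := sub_pos.2 (T.node_lt k (by omega))
  have hk1 := sub_pos.2 (T.node_lt (k + 1) hiN)
  unfold Mesh.hat
  rw [Nat.add_sub_cancel]
  have hj' := sub_pos.2 (T.node_lt j hj)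
  rcases lt_trichotomy j k with h | rfl | h
  · have h1 := T.node_le_node (show j + 1 ≤ k by omega) (by omega)
    have h2 : (x - T.node k) / (T.node (k + 1) - T.node k) ≤ 0 :=
      div_nonpos_of_nonpos_of_nonneg (by linarith [hx.2]) hk.le
    rw [max_eq_left ((min_le_left _ _).trans h2), if_neg (by omega), if_neg (by omega)]
    simp
  · have h1 : (x - T.node j) / (T.node (j + 1) - T.node j) ≤ 1 := by
      rw [div_le_one hk]; linarith [hx.2]
    have h0 : 0 ≤ (x - T.node j) / (T.node (j + 1) - T.node j) :=
      div_nonneg (by linarith [hx.1]) hk.le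
    have h2 : 1 ≤ (T.node (j + 1 + 1) - x) / (T.node (j + 1 + 1) - T.node (j + 1)) := by
      rw [one_le_div hk1]; linarith [hx.2]
    rw [min_eq_left (h1.trans h2), max_eq_right h0, if_neg (by omega), if_pos rfl]
    ring
  · rcases (show k + 1 ≤ j by omega).eq_or_lt with rfl | h
    · have h1 : (T.node (k + 1 + 1) - x) / (T.node (k + 1 + 1) - T.node (k + 1)) ≤ 1 := by
        rw [div_le_one hk1]; linarith [hx.1]
      have h0 : 0 ≤ (T.node (k + 1 + 1) - x) / (T.node (k + 1 + 1) - T.node (k + 1)) :=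
        div_nonneg (by linarith [hx.2]) hk1.le
      have h2 : 1 ≤ (x - T.node k) / (T.node (k + 1) - T.node k) := by
        rw [one_le_div hk]; linarith [hx.1]
      rw [min_eq_right (h1.trans h2), max_eq_right h0, if_pos rfl, if_neg (by omega)]
      field_simp
      ring
    · have h1 := T.node_le_node (show k + 1 + 1 ≤ j by omega) (by omega)
      have h2 : (T.node (k + 1 + 1) - x) / (T.node (k + 1 + 1) - T.node (k + 1)) ≤ 0 :=
        div_nonpos_of_nonpos_of_nonneg (by linarith [hx.1]) hk1.le
      rw [max_eq_left ((min_le_right _ _).trans h2), if_neg (by omega), if_neg (by omega)]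
      simp

/-- `Mesh.msSpace` is spanned by whatever satisfies a predicate, so interpolation requires proving
that basis functions exist. The primitive with nodal values `δ_ij` and elementwise constant flux
works: tested with `v`, it gives a constant times `∫ v' = 0`. -/
theorem Mesh.exists_isBasisFunction {L α₁ α₂ : ℝ} (hL : 0 < L) (T : Mesh L) {A : ℝ → ℝ}
    (hA : IsCoefficient 0 L α₁ α₂ A) {i : ℕ} (hi : 1 ≤ i) (hiN : i < T.N) :
    ∃ ψ γ, T.IsBasisFunction A i ψ ∧ IsPrimitive 0 L ψ γ ∧
      ∀ j ≤ T.N, ∫ y in (0 : ℝ)..T.node j, γ y = if j = i then 1 else 0 := by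
  obtain ⟨γ, hγ, hγK, hγn⟩ := T.exists_nodal_values hA (fun j => if j = i then 1 else 0)
    (if_neg (by omega))
  have hψ : IsPrimitive 0 L (fun x => ∫ y in (0 : ℝ)..x, γ y) γ := by
    refine ⟨hγ, Filter.EventuallyEq.rfl, ?_⟩
    have := hγn T.N le_rfl
    rwa [T.node_last, if_neg (by omega), intervalIntegral_eq_Ioo hL.le] at this
  refine ⟨_, γ, ⟨hψ.memH10 hL.le, fun j hj => ⟨?_, fun v hv => ?_⟩⟩, hψ, hγn⟩
  · have hlt := T.node_lt j hj
    have hsub := T.Ioo_subset hj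
    have hγj := hγ.mono hsub
    set m : ℝ := ((if j + 1 = i then 1 else 0) - (if j = i then 1 else 0)) /
        (T.node (j + 1) - T.node j) with hm
    have hml : m * (T.node (j + 1) - T.node j) =
        (if j + 1 = i then 1 else 0) - (if j = i then 1 else 0) :=
      div_mul_cancel₀ _ (sub_pos.2 hlt).ne'
    have hmL : MemL2 (T.node j) (T.node (j + 1)) fun _ => m :=
      memL2_of_continuousOn continuousOn_const
    refine IsPrimitive.memH10 (g := fun x => γ x - m) ⟨hγj.sub hmL, ?_, ?_⟩ hlt.le
    · filter_upwards [ae_restrict_mem measurableSet_Ioo] with x hx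
      have hint := (hγj.mono (Ioo_subset_Ioo_right hx.2.le)).intervalIntegrable hx.1.le
      rw [Pi.sub_apply, T.primitive_node_succ hγ hj (Ioo_subset_Icc_self hx), hγn j hj.le,
        T.hat_eq hi hiN hj hx, intervalIntegral.integral_sub hint intervalIntegrable_const,
        intervalIntegral.integral_const, smul_eq_mul]
      ring
    · have h1 := T.primitive_node_succ hγ hj (right_mem_Icc.2 hlt.le)
      rw [hγn j hj.le, hγn (j + 1) hj, intervalIntegral_eq_Ioo hlt.le] at h1
      rw [integral_sub hγj.integrableOn hmL.integrableOn]
      simp only [integral_const, MeasurableSet.univ, measureReal_restrict_apply, univ_inter,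
        Real.volume_real_Ioo_of_le hlt.le, smul_eq_mul]
      linarith
  · obtain ⟨c, hc⟩ := hγK j hj
    have hlt := T.node_lt j hj
    have hsub := T.Ioo_subset hj
    obtain ⟨η, hη⟩ := hv.exists_isPrimitive hlt
    have hw := weakDeriv_ae_eq (hγ.mono hsub) ((hψ.hasWeakDeriv hL.le).mono hsub)
    have e : ∫ x in Ioo (T.node j) (T.node (j + 1)), A x *
        weakDeriv (T.node j) (T.node (j + 1)) (fun x => ∫ y in (0 : ℝ)..x, γ y) x *
          weakDeriv (T.node j) (T.node (j + 1)) v x =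
        ∫ x in Ioo (T.node j) (T.node (j + 1)), c * η x := by
      apply integral_congr_ae
      filter_upwards [hw, hη.weakDeriv_ae_eq hlt.le, (hA.mono hsub).bounds,
        ae_restrict_mem measurableSet_Ioo] with x hx hy hxA hxm
      have : A x ≠ 0 := (hA.pos.trans_le hxA.1).ne'
      rw [hx, hy, hc x hxm]
      field_simp
    rw [e, integral_const_mul, hη.integral_eq_zero, mul_zero]

/-- The interpolant in the multiscale space of a function of `H¹₀`. -/
theorem Mesh.exists_interpolant {L α₁ α₂ : ℝ} (hL : 0 < L) (T : Mesh L) {A u g : ℝ → ℝ}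
    (hA : IsCoefficient 0 L α₁ α₂ A) (hu : IsPrimitive 0 L u g) :
    ∃ v γ, v ∈ T.msSpace A ∧ IsPrimitive 0 L v γ ∧
      ∀ j ≤ T.N, ∫ y in (0 : ℝ)..T.node j, γ y = ∫ y in (0 : ℝ)..T.node j, g y := by
  set d : ℕ → ℝ := fun j => ∫ y in (0 : ℝ)..T.node j, g y with hd
  -- Nodes are matched one at a time, with value `0` at those not yet reached. Stopping at `N - 1`
  -- suffices because `u` vanishes at the last node.
  have key : ∀ n, n < T.N → ∃ v γ, v ∈ T.msSpace A ∧ IsPrimitive 0 L v γ ∧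
      ∀ j ≤ T.N, ∫ y in (0 : ℝ)..T.node j, γ y = if j ≤ n then d j else 0 := by
    intro n
    induction n with
    | zero =>
      intro _
      refine ⟨0, 0, Submodule.zero_mem _, isPrimitive_zero 0 L, fun j hj => ?_⟩
      split_ifs with h
      · obtain rfl : j = 0 := by omega
        simp [hd, T.node_zero]
      · simp
    | succ n ih =>
      intro hn
      obtain ⟨v, γ, hv, hvγ, hj⟩ := ih (by omega)
      obtain ⟨ψ, η, hψ, hψη, hj'⟩ := T.exists_isBasisFunction hL hA (i := n + 1) (by omega) hn
      refine ⟨v + d (n + 1) • ψ, γ + d (n + 1) • η, ?_, hvγ.add (hψη.const_smul _), ?_⟩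
      · exact Submodule.add_mem _ hv (Submodule.smul_mem _ _
          (Submodule.subset_span ⟨n + 1, by omega, hn, hψ⟩))
      · intro j hjN
        have hm := T.node_mem_Icc hjN
        have hsub : Ioo 0 (T.node j) ⊆ Ioo 0 L := Ioo_subset_Ioo_right hm.2
        simp only [Pi.add_apply, Pi.smul_apply, smul_eq_mul]
        rw [intervalIntegral.integral_add ((hvγ.memL2.mono hsub).intervalIntegrable hm.1)
          (((hψη.memL2.mono hsub).intervalIntegrable hm.1).const_mul _),
          intervalIntegral.integral_const_mul, hj j hjN, hj' j hjN]
        rcases lt_trichotomy j (n + 1) with h | rfl | h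
        · rw [if_pos (by omega), if_neg (by omega), if_pos (by omega)]; ring
        · rw [if_neg (by omega), if_pos rfl, if_pos le_rfl]; ring
        · rw [if_neg (by omega), if_neg (by omega), if_neg (by omega)]; ring
  have hN : T.N ≠ 0 := by
    intro h0
    have := T.node_last
    rw [h0, T.node_zero] at this
    linarith
  obtain ⟨v, γ, hv, hvγ, hj⟩ := key (T.N - 1) (by omega)
  refine ⟨v, γ, hv, hvγ, fun j hjN => ?_⟩
  rw [hj j hjN]
  split_ifs with h
  · rfl
  · obtain rfl : j = T.N := by omega
    rw [T.node_last, intervalIntegral_eq_Ioo hL.le, hu.integral_eq_zero]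

/-! ### The error estimate -/

/-- If `x > (√p + q) y`, then multiplying by `x ≥ √p y` gives `x² > p y² + q y x`. -/
theorem le_of_sq_le_sq_mul_add {x y p q : ℝ} (hy : 0 ≤ y) (hp : 0 ≤ p) (hq : 0 ≤ q)
    (h : x ^ 2 ≤ p * y ^ 2 + q * y * x) : x ≤ (√p + q) * y := by
  by_contra! hlt
  have hs := Real.sq_sqrt hp
  have h0 := Real.sqrt_nonneg p
  have h1 : √p * y ≤ x := by nlinarith [mul_nonneg hq hy]
  have hx' : 0 < x := lt_of_le_of_lt (by positivity) hlt
  have h2 : (√p + q) * y * x < x * x := mul_lt_mul_of_pos_right hlt hx'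
  have h3 : √p * y * (√p * y) ≤ √p * y * x := mul_le_mul_of_nonneg_left h1 (by positivity)
  nlinarith

/-- The interpolation error. -/
theorem Mesh.l2Norm_interpolation_error_le {L α₁ α₂ b : ℝ} (hL : 0 < L) (hα : α₁ ≤ α₂) (T : Mesh L)
    {A f u g v h : ℝ → ℝ} (hA : IsCoefficient 0 L α₁ α₂ A) (hf : MemL2 0 L f)
    (hu : IsPrimitive 0 L u g) (hsol : IsWeakSolution L A b f u) (hv : IsPrimitive 0 L v h)
    (hflux : T.ElementwiseFlux A h)
    (hn : ∀ j ≤ T.N, ∫ y in (0 : ℝ)..T.node j, (g - h) y = 0) :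
    l2Norm 0 L (g - h) ≤ T.size * (1 + √(2 * α₂ * L * |b|) / α₁) * (l2Norm 0 L f / α₁) := by
  have hα₁ := hA.pos
  have hw := hu.sub hv
  have hF := l2Norm_nonneg 0 L f
  have hG := l2Norm_nonneg 0 L g
  have hH := T.size_nonneg
  -- The equation is tested with the interpolation error itself; orthogonality then removes `v` from
  -- the energy.
  have h1 := hsol.2 _ (hw.memH10 hL.le)
  rw [advDiffForm_eq hL.le hA hu hw, loadForm] at h1
  have h2 := hflux.integral_eq_zero hL.le hA hv.memL2 hw.memL2 hn
  have e : (fun x => A x * (g - h) x * (g - h) x) =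
      fun x => A x * g x * (g - h) x - A x * h x * (g - h) x := by
    ext x; simp only [Pi.sub_apply]; ring
  have h3 : ∫ x in Ioo 0 L, A x * (g - h) x * (g - h) x =
      (∫ x in Ioo 0 L, f x * (u - v) x) - b * ∫ x in Ioo 0 L, g x * (u - v) x := by
    rw [e, integral_sub ((hA.memL2_mul hu.memL2).integrable_mul hw.memL2)
      ((hA.memL2_mul hv.memL2).integrable_mul hw.memL2), h2]
    linarith
  have hwL := hw.memL2_left hL.le
  have h4 : -(b * ∫ x in Ioo 0 L, g x * (u - v) x) ≤
      |b| * (l2Norm 0 L g * l2Norm 0 L (u - v)) := by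
    refine (neg_le_abs _).trans ?_
    rw [abs_mul]
    exact mul_le_mul_of_nonneg_left (abs_integral_mul_le hu.memL2 hwL) (abs_nonneg b)
  have h5 := T.l2Norm_le_size_mul hL.le hw hn
  have h6 := abs_mul_l2Norm_deriv_le hL hα hA hf hu hsol
  have h7 : α₁ * l2Norm 0 L (g - h) ^ 2 ≤
      (T.size * (1 + √(2 * α₂ * L * |b|) / α₁) * l2Norm 0 L f) * l2Norm 0 L (g - h) := by
    calc α₁ * l2Norm 0 L (g - h) ^ 2 ≤ _ := hA.mul_sq_l2Norm_le hw.memL2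
      _ ≤ l2Norm 0 L f * l2Norm 0 L (u - v) + |b| * (l2Norm 0 L g * l2Norm 0 L (u - v)) := by
          rw [h3]
          linarith [integral_mul_le hf hwL]
      _ = (l2Norm 0 L f + |b| * l2Norm 0 L g) * l2Norm 0 L (u - v) := by ring
      _ ≤ (l2Norm 0 L f + √(2 * α₂ * L * |b|) / α₁ * l2Norm 0 L f) *
          (T.size * l2Norm 0 L (g - h)) := by
          have := l2Norm_nonneg 0 L (u - v)
          gcongr
      _ = _ := by ring
  rcases (l2Norm_nonneg 0 L (g - h)).eq_or_lt with h0 | h0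
  · rw [← h0]
    positivity
  · rw [← mul_div_assoc, le_div_iff₀ hα₁]
    refine le_of_mul_le_mul_right ?_ h0
    linarith

/-- The Galerkin error is bounded by the interpolation error. -/
theorem Mesh.l2Norm_error_le {L α₁ α₂ b : ℝ} (hL : 0 < L) (hα : α₁ ≤ α₂) (T : Mesh L)
    {A f u g v h uH k : ℝ → ℝ} (hA : IsCoefficient 0 L α₁ α₂ A)
    (hu : IsPrimitive 0 L u g) (hsol : IsWeakSolution L A b f u)
    (hv : IsPrimitive 0 L v h) (hvT : v ∈ T.msSpace A)
    (hn : ∀ j ≤ T.N, ∫ y in (0 : ℝ)..T.node j, (g - h) y = 0)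
    (hk : IsPrimitive 0 L uH k) (huH : T.IsMsFEMSolution A b f uH) :
    l2Norm 0 L (g - k) ≤ (√(α₂ / α₁) + |b| * T.size / α₁) * l2Norm 0 L (g - h) := by
  have hα₁ := hA.pos
  have hα₂ : 0 < α₂ := hα₁.trans_le hα
  have he := hu.sub hk
  have hw := hu.sub hv
  have hzT : v - uH ∈ T.msSpace A := Submodule.sub_mem _ hvT huH.1
  obtain ⟨z, hz, hzflux⟩ := Mesh.exists_isPrimitive_of_mem_msSpace hL hA hzT
  have hgz : z =ᵐ[volume.restrict (Ioo 0 L)] h - k :=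
    (hz.weakDeriv_ae_eq hL.le).symm.trans ((hv.sub hk).weakDeriv_ae_eq hL.le)
  have hwL := hw.memL2_left hL.le
  have hzL := hz.memL2_left hL.le
  have hH := T.size_nonneg
  have hE := l2Norm_nonneg 0 L (g - k)
  have hW := l2Norm_nonneg 0 L (g - h)
  -- Galerkin orthogonality
  have h1 : (∫ x in Ioo 0 L, A x * (g - k) x * z x) +
      b * ∫ x in Ioo 0 L, (g - k) x * (v - uH) x = 0 := by
    have ha := hsol.2 _ (hz.memH10 hL.le)
    have hb := huH.2 _ hzT
    rw [advDiffForm_eq hL.le hA hu hz] at ha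
    rw [advDiffForm_eq hL.le hA hk hz] at hb
    have e1 : (fun x => A x * (g - k) x * z x) = fun x => A x * g x * z x - A x * k x * z x := by
      ext x; simp only [Pi.sub_apply]; ring
    have e2 : (fun x => (g - k) x * (v - uH) x) =
        fun x => g x * (v - uH) x - k x * (v - uH) x := by
      ext x; simp only [Pi.sub_apply]; ring
    rw [e1, e2, integral_sub ((hA.memL2_mul hu.memL2).integrable_mul hz.memL2)
      ((hA.memL2_mul hk.memL2).integrable_mul hz.memL2),
      integral_sub (hu.memL2.integrable_mul hzL) (hk.memL2.integrable_mul hzL)]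
    linarith
  have h2 : ∫ x in Ioo 0 L, A x * (g - k) x * (g - k) x =
      (∫ x in Ioo 0 L, A x * (g - k) x * (g - h) x) + ∫ x in Ioo 0 L, A x * (g - k) x * z x := by
    rw [← integral_add ((hA.memL2_mul he.memL2).integrable_mul hw.memL2)
      ((hA.memL2_mul he.memL2).integrable_mul hz.memL2)]
    apply integral_congr_ae
    filter_upwards [hgz] with x hx
    rw [hx]; simp only [Pi.sub_apply]; ring
  have h3 : ∫ x in Ioo 0 L, A x * (g - k) x * (g - h) x =
      (∫ x in Ioo 0 L, A x * (g - h) x * (g - h) x) + ∫ x in Ioo 0 L, A x * z x * (g - h) x := by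
    rw [← integral_add ((hA.memL2_mul hw.memL2).integrable_mul hw.memL2)
      ((hA.memL2_mul hz.memL2).integrable_mul hw.memL2)]
    apply integral_congr_ae
    filter_upwards [hgz] with x hx
    rw [hx]; simp only [Pi.sub_apply]; ring
  rw [hzflux.integral_eq_zero hL.le hA hz.memL2 hw.memL2 hn, add_zero] at h3
  -- The convection term is moved from `z`, on which no smallness is known, to `w`, which gains a
  -- factor `H`; this is `∫ e' e = 0` with `e = w + z`.
  have h4 : (∫ x in Ioo 0 L, (g - k) x * (u - v) x) +
      ∫ x in Ioo 0 L, (g - k) x * (v - uH) x = 0 := by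
    refine Eq.trans ?_ (he.integral_mul_self hL.le)
    rw [← integral_add (he.memL2.integrable_mul hwL)
      (he.memL2.integrable_mul hzL)]
    congr 1
    ext x; simp only [Pi.sub_apply]; ring
  have h5 : b * (∫ x in Ioo 0 L, (g - k) x * (u - v) x) ≤
      |b| * (l2Norm 0 L (g - k) * (T.size * l2Norm 0 L (g - h))) := by
    refine (le_abs_self _).trans ?_
    rw [abs_mul]
    refine mul_le_mul_of_nonneg_left ((abs_integral_mul_le he.memL2 hwL).trans ?_) (abs_nonneg b)
    exact mul_le_mul_of_nonneg_left (T.l2Norm_le_size_mul hL.le hw hn) hE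
  have h6 : α₁ * l2Norm 0 L (g - k) ^ 2 ≤ α₂ * l2Norm 0 L (g - h) ^ 2 +
      |b| * (l2Norm 0 L (g - k) * (T.size * l2Norm 0 L (g - h))) := by
    have ha := hA.mul_sq_l2Norm_le he.memL2
    have hb := hA.integral_le_mul_sq_l2Norm hw.memL2
    have hc : b * (∫ x in Ioo 0 L, (g - k) x * (u - v) x) =
        -(b * ∫ x in Ioo 0 L, (g - k) x * (v - uH) x) := by
      linear_combination b * h4
    linarith
  apply le_of_sq_le_sq_mul_add hW (by positivity) (by positivity)
  refine le_of_mul_le_mul_left (h6.trans_eq ?_) hα₁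
  field_simp

end MsFEM

/-! ### The main theorem: combining the interpolation and Galerkin bounds. -/

theorem mainTheorem2 (L α₁ α₂ b : ℝ) (hL : 0 < L) (hα₁ : 0 < α₁) (hα₂ : α₁ ≤ α₂)
    (hb : b ≠ 0) (hPe : 1 ≤ |b| * L / α₂)
    (f : ℝ → ℝ) (hf : MsFEM.MemL2 0 L f)
    (T : MsFEM.Mesh L)
    (A : ℝ → ℝ → ℝ)
    (hA_meas : ∀ ε > 0, AEMeasurable (A ε) (volume.restrict (Ioo 0 L)))
    (hA : ∀ ε > 0, ∀ᵐ x ∂(volume.restrict (Ioo 0 L)), α₁ ≤ A ε x ∧ A ε x ≤ α₂) :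
    ∀ ε > 0, ∀ u uH : ℝ → ℝ,
      MsFEM.IsWeakSolution L (A ε) b f u →
      T.IsMsFEMSolution (A ε) b f uH →
      MsFEM.h1Seminorm 0 L (u - uH) ≤
        T.size * (√(α₂ / α₁) + |b| * T.size / α₁) *
          (1 + √(2 * α₂ * L * |b|) / α₁) * (MsFEM.l2Norm 0 L f / α₁) := by
  intro ε hε u uH hsol huH
  have hC : MsFEM.IsCoefficient 0 L α₁ α₂ (A ε) := ⟨hα₁, hA_meas ε hε, hA ε hε⟩
  obtain ⟨g, hu⟩ := hsol.1.exists_isPrimitive hL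
  obtain ⟨k, hk, -⟩ := MsFEM.Mesh.exists_isPrimitive_of_mem_msSpace hL hC huH.1
  obtain ⟨v, h, hvT, hv, hvn⟩ := T.exists_interpolant hL hC hu
  have hn : ∀ j ≤ T.N, ∫ y in (0 : ℝ)..T.node j, (g - h) y = 0 := by
    intro j hj
    have hm := T.node_mem_Icc hj
    have hsub : Ioo 0 (T.node j) ⊆ Ioo 0 L := Ioo_subset_Ioo_right hm.2
    simp only [Pi.sub_apply]
    rw [intervalIntegral.integral_sub ((hu.memL2.mono hsub).intervalIntegrable hm.1)
      ((hv.memL2.mono hsub).intervalIntegrable hm.1), hvn j hj, sub_self]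
  have h1 := T.l2Norm_interpolation_error_le hL hα₂ hC hf hu hsol hv
    (MsFEM.Mesh.elementwiseFlux_of_mem_msSpace hL hC hvT hv) hn
  have h2 := T.l2Norm_error_le hL hα₂ hC hu hsol hv hvT hn hk huH
  have h3 : 0 ≤ √(α₂ / α₁) + |b| * T.size / α₁ := by
    have := T.size_nonneg
    positivity
  unfold MsFEM.h1Seminorm
  rw [MsFEM.l2Norm_congr ((hu.sub hk).weakDeriv_ae_eq hL.le)]
  refine (h2.trans (mul_le_mul_of_nonneg_left h1 h3)).trans_eq ?_
  ring
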